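/- Let $\Omega\subset\mathbb{R}^n$ be a bounded open set. Let $W^{1,\infty}_0(\Omega)$ be the set of all $u\in L^\infty(\Omega)$ whose weak gradient belongs to $L^\infty(\Omega,\mathbb{R}^n)$ and which have a representative that extends continuously to $\overline\Omega$ with value $0$ on $\partial\Omega$. Define $\mathcal{J}:L^2(\Omega)\to[0,\infty]$ by $\mathcal{J}(u)=\|\nabla u\|_{\infty}=\operatorname{ess\,sup}_\Omega|\nabla u|$ (Euclidean norm) if $u\in W^{1,\infty}_0(\Omega)$, and $\mathcal{J}(u)=+\infty$ otherwise, and let $$\partial\mathcal{J}(u)=\{\zeta\in L^2(\Omega): \mathcal{J}(u)+\langle\zeta,v-u\rangle_{L^2(\Omega)}\le\mathcal{J}(v)\ \text{ for all } v\in L^2(\Omega)\}$$ be its $L^2$-subdifferential. Let $$G^1_0(\Omega)=\{\nabla\varphi : \varphi\in H^1_0(\Omega),\ \Delta\varphi\in L^2(\Omega)\},$$ where $\Delta$ is the distributional Laplacian on $\Omega$ and $H^1_0(\Omega)$ is the closure of $C_c^\infty(\Omega)$ in $H^1(\Omega)$. Let $\mathcal{M}(\Omega,\mathbb{R}^n)$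 be the space of finite $\mathbb{R}^n$-valued Radon measures $\mu$ on $\Omega$, with total variation measure $|\mu|$ taken with respect to the Euclidean norm. Divergences of such measures are distributional: $\operatorname{div}\mu=f$ with $f\in L^2(\Omega)$ means $\int_\Omega\nabla\varphi\cdot\mathrm{d}\mu=-\int_\Omega f\varphi\,\mathrm{d}x$ for all $\varphi\in C_c^\infty(\Omega)$. Let $\mathcal{N}(\operatorname{div};\Omega)=\{r\in\mathcal{M}(\Omega,\mathbb{R}^n):\operatorname{div} r=0\}$. A field $g\in G^1_0(\Omega)$ is identified with the measure $g\,\mathrm{d}x$. Then for every $u\in L^2(\Omega)$ $$\partial\mathcal{J}(u)=\Big\{-\operatorname{div} q\ :\ q=g+r\in\mathcal{M}(\Omega,\mathbb{R}^n),\ g\in G^1_0(\Omega),\ r\in\mathcal{N}(\operatorname{div};\Omega),\ \int_\Omega-(\operatorname{div} q)\,u\,\mathrm{d}x=\mathcal{J}(u),\ |q|(\Omega)\le 1\Big\}.$$ -/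

import Mathlib

open MeasureTheory Filter Topology TopologicalSpace Set
open scoped ENNReal Distributions Gradient

noncomputable section

section Subdifferential

variable {H : Type*} [NormedAddCommGroup H] [InnerProductSpace ℝ H]

/-- The subdifferential at `u` of an extended-real-valued functional `F` on a real Hilbert space:
all `ζ` with `F v ≥ F u + ⟪ζ, v - u⟫` for every `v`. -/
def subdifferential (F : H → EReal) (u : H) : Set H :=
  {ζ | ∀ v : H, F u + ((inner ℝ ζ (v - u) : ℝ) : EReal) ≤ F v}

end Subdifferential

section Spaces

variable {n : ℕ} (Ω : Opens (EuclideanSpace ℝ (Fin n)))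

/-- Lebesgue measure on the open set `Ω`. -/
abbrev lebesgueOn : Measure (EuclideanSpace ℝ (Fin n)) :=
  volume.restrict (Ω : Set (EuclideanSpace ℝ (Fin n)))

/-- The real Hilbert space `L²(Ω)`. -/
abbrev L2 : Type := Lp ℝ 2 (lebesgueOn Ω)

/-- `G` is the weak (distributional) gradient of `u` on `Ω`: both are locally integrable on `Ω`
and `∫ u ∇φ = - ∫ φ G` for every test function `φ ∈ C_c^∞(Ω)`. -/
structure HasWeakGradient (u : EuclideanSpace ℝ (Fin n) → ℝ)
    (G : EuclideanSpace ℝ (Fin n) → EuclideanSpace ℝ (Fin n)) : Prop where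
  locallyIntegrableOn : LocallyIntegrableOn u Ω
  locallyIntegrableOn_grad : LocallyIntegrableOn G Ω
  integral_eq : ∀ φ : 𝓓(Ω, ℝ), ∫ x in Ω, u x • ∇ (φ : EuclideanSpace ℝ (Fin n) → ℝ) x
    = - ∫ x in Ω, φ x • G x

/-- `f` is the weak (distributional) divergence on `Ω` of the vector field `g`: both are locally
integrable on `Ω` and `∫ g · ∇φ = - ∫ f φ` for every test function `φ ∈ C_c^∞(Ω)`. -/
structure HasWeakDivergence (g : EuclideanSpace ℝ (Fin n) → EuclideanSpace ℝ (Fin n))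
    (f : EuclideanSpace ℝ (Fin n) → ℝ) : Prop where
  locallyIntegrableOn : LocallyIntegrableOn g Ω
  locallyIntegrableOn_div : LocallyIntegrableOn f Ω
  integral_eq : ∀ φ : 𝓓(Ω, ℝ),
    ∫ x in Ω, (inner ℝ (∇ (φ : EuclideanSpace ℝ (Fin n) → ℝ) x) (g x) : ℝ)
      = - ∫ x in Ω, f x * φ x

open Classical in
/-- The weak gradient of `u` on `Ω`. It is unique up to equality almost everywhere on `Ω`;
the value is `0` if `u` has no weak gradient. -/
def weakGradient (u : EuclideanSpace ℝ (Fin n) → ℝ) :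
    EuclideanSpace ℝ (Fin n) → EuclideanSpace ℝ (Fin n) :=
  if h : ∃ G, HasWeakGradient Ω u G then h.choose else 0

/-- `u ∈ W^{1,∞}_0(Ω)`: `u` and its weak gradient are essentially bounded on `Ω`, and `u` agrees
a.e. on `Ω` with a function that is continuous on the closure of `Ω` and vanishes on `∂Ω`. -/
structure MemW1InfZero (u : EuclideanSpace ℝ (Fin n) → ℝ) : Prop where
  memLp : MemLp u ∞ (lebesgueOn Ω)
  exists_grad : ∃ G, HasWeakGradient Ω u G ∧ MemLp G ∞ (lebesgueOn Ω)
  zero_boundary : ∃ w : EuclideanSpace ℝ (Fin n) → ℝ,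
    ContinuousOn w (closure (Ω : Set (EuclideanSpace ℝ (Fin n)))) ∧
    w =ᵐ[lebesgueOn Ω] u ∧
    ∀ x ∈ frontier (Ω : Set (EuclideanSpace ℝ (Fin n))), w x = 0

open Classical in
/-- The functional `𝒥` on `L²(Ω)`: the essential supremum of the Euclidean norm of the weak
gradient on `W^{1,∞}_0(Ω)`, and `+∞` elsewhere. -/
def functionalJ (u : L2 Ω) : EReal :=
  if MemW1InfZero Ω u then ((eLpNorm (weakGradient Ω u) ∞ (lebesgueOn Ω) : ℝ≥0∞) : EReal) else ⊤

/-- `φ ∈ H^1_0(Ω)`: `φ` lies in the closure of `C_c^∞(Ω)` with respect to the `H^1(Ω)` norm. -/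
def MemH1Zero (φ : EuclideanSpace ℝ (Fin n) → ℝ) : Prop :=
  MemLp φ 2 (lebesgueOn Ω) ∧
  ∃ G, HasWeakGradient Ω φ G ∧ MemLp G 2 (lebesgueOn Ω) ∧
    ∃ ψ : ℕ → 𝓓(Ω, ℝ),
      Tendsto (fun k => eLpNorm (fun x => ψ k x - φ x) 2 (lebesgueOn Ω)) atTop (𝓝 0) ∧
      Tendsto (fun k => eLpNorm
        (fun x => ∇ (ψ k : EuclideanSpace ℝ (Fin n) → ℝ) x - G x) 2 (lebesgueOn Ω)) atTop (𝓝 0)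

/-- `g ∈ G^1_0(Ω)`: `g` is the weak gradient of some `φ ∈ H^1_0(Ω)` whose distributional
Laplacian `div ∇φ` belongs to `L²(Ω)`. -/
def MemG1Zero (g : EuclideanSpace ℝ (Fin n) → EuclideanSpace ℝ (Fin n)) : Prop :=
  ∃ φ, MemH1Zero Ω φ ∧ HasWeakGradient Ω φ g ∧
    ∃ f, MemLp f 2 (lebesgueOn Ω) ∧ HasWeakDivergence Ω g f

/-- `μ ∈ ℳ(Ω, ℝⁿ)`: `μ` is a finite `ℝⁿ`-valued Radon measure on `Ω`, seen as a Borel vector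
measure on `ℝⁿ` that is carried by `Ω`. (Finite Borel measures on `ℝⁿ` are Radon.) The total
variation measure `μ.variation` is taken with respect to the Euclidean norm of `ℝⁿ`. -/
structure IsVectorRadonMeasure
    (μ : VectorMeasure (EuclideanSpace ℝ (Fin n)) (EuclideanSpace ℝ (Fin n))) : Prop where
  finite : IsFiniteMeasure μ.variation
  carried : μ.variation (Ω : Set (EuclideanSpace ℝ (Fin n)))ᶜ = 0

/-- The distributional divergence of the vector measure `μ` on `Ω` is the function `f`:
`∫ ∇φ · dμ = - ∫ f φ` for every test function `φ ∈ C_c^∞(Ω)`. -/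
def HasMeasureDivergence
    (μ : VectorMeasure (EuclideanSpace ℝ (Fin n)) (EuclideanSpace ℝ (Fin n)))
    (f : EuclideanSpace ℝ (Fin n) → ℝ) : Prop :=
  ∀ φ : 𝓓(Ω, ℝ),
    μ.integral (∇ (φ : EuclideanSpace ℝ (Fin n) → ℝ)) (innerSL ℝ) = - ∫ x in Ω, f x * φ x

/-- `r ∈ 𝒩(div; Ω)`: the solenoidal finite vector Radon measures on `Ω`. -/
def MemSolenoidal
    (r : VectorMeasure (EuclideanSpace ℝ (Fin n)) (EuclideanSpace ℝ (Fin n))) : Prop :=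
  IsVectorRadonMeasure Ω r ∧ HasMeasureDivergence Ω r (fun _ => 0)

end Spaces

end

/-!
Since `𝒥` is positively homogeneous with `𝒥 0 = 0`, a function `ζ` is a subgradient at `u` if and
only if `⟪ζ, u⟫ = 𝒥 u` and `⟪ζ, v⟫ ≤ 𝒥 v` for all `v` (the direct implication is
`inner_eq_and_le_of_mem_subdifferential`). So the point is that `⟪ζ, ·⟫ ≤ 𝒥` holds exactly for the
divergences `ζ = -div q` of measures `q` on `Ω` with `|q|(Ω) ≤ 1`, and that the divergence of such
a `q` is also that of a field in `G¹₀(Ω)`.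

If `ζ = -div q`, then `⟪ζ, φ⟫ = ∫ ∇φ · dq ≤ sup |∇φ|` for test functions `φ`. An element `v` of
`W^{1,∞}_0(Ω)` with `|∇v| ≤ L` extends by zero to an `L`-Lipschitz function
(`HasWeakGradient.lipschitzWith_indicator`, by mollification along segments in `Ω`), and soft
thresholding followed by mollification gives test functions `φ` close to `v` with `|∇φ| ≤ L`
(`MemW1InfZero.exists_testFunction`). Passing to the limit, `⟪ζ, v⟫ ≤ 𝒥 v`.

Conversely, if `⟪ζ, ·⟫ ≤ 𝒥`, then `⟪ζ, φ⟫ ≤ sup |∇φ|` on test functions. A vector-valued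
Riesz representation with the sharp constant for the Euclidean norm is obtained from two
applications of the Mazur–Orlicz theorem (`exists_linearMap_le_of_le_sublinear_comp`): one in
`C_c`, with the supremum of the positive part as sublinear functional, gives through the scalar
Riesz–Markov–Kakutani theorem a measure `ν` of mass at most `1` with `⟪ζ, φ⟫ ≤ ∫ |∇φ| dν`; the
other, in the Hilbert space `L²(ν; ℝⁿ)` with the `L¹(ν)` norm, gives a density `σ` with
`⟪ζ, φ⟫ = ∫ σ · ∇φ dν` and `∫ |σ| dν ≤ 1` (`exists_density_integral_inner_gradient`). The measure
`q` is the restriction of `σ ν` to `Ω`.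

The field `g ∈ G¹₀(Ω)` with `div g = div q` solves the Poisson equation with zero boundary values
(`exists_memG1Zero_hasWeakDivergence`), and `r = q - g dx` is solenoidal.
-/

/-! ### Domination by sublinear functionals -/

section SublinearDomination

/-- **Mazur–Orlicz theorem** for a linear functional `l` on `V` dominated by a sublinear functional
`N` on `F` along a map `A : V → F` that is positively homogeneous and subadditive as seen by `N`.
It is the Hahn–Banach theorem for the sublinear functional `f ↦ ⨅ v, N (f + A v) - l v`. -/
theorem exists_linearMap_le_of_le_sublinear_comp {V F : Type*} [AddCommGroup V] [Module ℝ V]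
    [AddCommGroup F] [Module ℝ F] (l : V →ₗ[ℝ] ℝ) (A : V → F) (N : F → ℝ)
    (N_hom : ∀ c : ℝ, 0 < c → ∀ f, N (c • f) = c * N f)
    (N_add : ∀ f g, N (f + g) ≤ N f + N g)
    (A_zero : A 0 = 0) (A_hom : ∀ c : ℝ, 0 < c → ∀ v, A (c • v) = c • A v)
    (A_add : ∀ f v w, N (f + A (v + w)) ≤ N (f + (A v + A w)))
    (h : ∀ v, l v ≤ N (A v)) :
    ∃ Λ : F →ₗ[ℝ] ℝ, (∀ f, Λ f ≤ N f) ∧ ∀ v, l v ≤ Λ (A v) := by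
  have N_zero : N 0 = 0 := by
    have := N_hom 2 two_pos 0
    rw [smul_zero] at this
    linarith
  let P : F → ℝ := fun f ↦ ⨅ v, (N (f + A v) - l v)
  have bdd : ∀ f, BddBelow (range fun v ↦ N (f + A v) - l v) := by
    rintro f
    refine ⟨-N (-f), ?_⟩
    rintro _ ⟨v, rfl⟩
    have h1 := N_add (f + A v) (-f)
    rw [add_neg_cancel_comm] at h1
    have h2 := h v
    simp only
    linarith
  have P_le : ∀ f v, P f ≤ N (f + A v) - l v := fun f v ↦ ciInf_le (bdd f) v
  obtain ⟨Λ, -, hΛ⟩ := exists_extension_of_le_sublinear (E := F) ⟨⊥, 0⟩ P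
    (by
      intro c hc f
      have hsurj : Function.Surjective (fun v : V ↦ c • v) :=
        fun v ↦ ⟨c⁻¹ • v, smul_inv_smul₀ hc.ne' v⟩
      simp only [P]
      rw [Real.mul_iInf_of_nonneg hc.le, ← hsurj.iInf_comp]
      congr 1
      ext v
      rw [A_hom c hc, ← smul_add, N_hom c hc, map_smul, smul_eq_mul]
      ring)
    (by
      intro f g
      refine le_ciInf_add_ciInf fun v w ↦ (P_le _ (v + w)).trans ?_
      have h1 := A_add (f + g) v w
      have h2 := N_add (f + A v) (g + A w)
      rw [add_add_add_comm] at h2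
      rw [map_add]
      linarith)
    (by
      rintro ⟨x, hx⟩
      obtain rfl : x = 0 := hx
      refine le_ciInf fun v ↦ ?_
      have := h v
      simp only [zero_add]
      change (0 : ℝ) ≤ _
      linarith)
  refine ⟨Λ, fun f ↦ (hΛ f).trans ?_, fun v ↦ ?_⟩
  · simpa [A_zero] using P_le f 0
  · have := (hΛ (-A v)).trans (P_le (-A v) v)
    rw [neg_add_cancel, N_zero, map_neg] at this
    linarith

/-- A linear functional `l` on `V`, dominated along `A : V → H` by a sublinear functional `N` which
is bounded on the Hilbert space `H`, is `v ↦ ⟪σ, A v⟫` for some `σ` with `⟪σ, ·⟫ ≤ N`. -/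
theorem exists_inner_eq_of_le_sublinear_comp {V H : Type*} [AddCommGroup V] [Module ℝ V]
    [NormedAddCommGroup H] [InnerProductSpace ℝ H] [CompleteSpace H]
    (l : V →ₗ[ℝ] ℝ) (A : V →ₗ[ℝ] H) (N : H → ℝ)
    (N_hom : ∀ c : ℝ, 0 < c → ∀ f, N (c • f) = c * N f)
    (N_add : ∀ f g, N (f + g) ≤ N f + N g)
    (C : ℝ) (N_le : ∀ f, N f ≤ C * ‖f‖) (h : ∀ v, l v ≤ N (A v)) :
    ∃ σ : H, (∀ f, inner ℝ σ f ≤ N f) ∧ ∀ v, inner ℝ σ (A v) = l v := by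
  obtain ⟨Λ, hΛN, hΛl⟩ := exists_linearMap_le_of_le_sublinear_comp l A N N_hom N_add (map_zero A)
    (fun c _ v ↦ map_smul A c v) (fun f v w ↦ by rw [map_add]) h
  let Λ' : H →L[ℝ] ℝ := Λ.mkContinuous C fun f ↦ by
    refine abs_le.2 ⟨?_, (hΛN f).trans (N_le f)⟩
    have := (hΛN (-f)).trans (N_le (-f))
    rw [map_neg, norm_neg] at this
    linarith
  have key : ∀ f, inner ℝ ((InnerProductSpace.toDual ℝ H).symm Λ') f = Λ f := fun f ↦ by
    rw [InnerProductSpace.toDual_symm_apply]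
    rfl
  refine ⟨(InnerProductSpace.toDual ℝ H).symm Λ', fun f ↦ (key f).trans_le (hΛN f),
    fun v ↦ (key _).trans (le_antisymm ?_ (hΛl v))⟩
  have := hΛl (-v)
  rw [map_neg, map_neg, map_neg] at this
  linarith

end SublinearDomination

/-! ### Test functions and their gradients -/

section TestFunctions

variable {E : Type*} [NormedAddCommGroup E] [InnerProductSpace ℝ E] [CompleteSpace E]
  {Ω : Opens E}

omit [CompleteSpace E] in
theorem TestFunction.differentiable (φ : 𝓓(Ω, ℝ)) : Differentiable ℝ φ :=
  φ.contDiff.differentiable (by simp)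

omit [CompleteSpace E] in
theorem testFunction_eq_zero_of_notMem (φ : 𝓓(Ω, ℝ)) {x : E} (hx : x ∉ Ω) : φ x = 0 := by
  by_contra h
  exact hx (φ.tsupport_subset (subset_tsupport _ h))

theorem gradient_testFunction_add (φ ψ : 𝓓(Ω, ℝ)) :
    ∇ (φ + ψ : 𝓓(Ω, ℝ)) = ∇ (φ : E → ℝ) + ∇ (ψ : E → ℝ) := by
  ext1 x
  have : fderiv ℝ (φ + ψ : 𝓓(Ω, ℝ)) x = fderiv ℝ φ x + fderiv ℝ ψ x :=
    fderiv_add φ.differentiable.differentiableAt ψ.differentiable.differentiableAt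
  rw [gradient, this, map_add]
  rfl

theorem gradient_testFunction_smul (c : ℝ) (φ : 𝓓(Ω, ℝ)) :
    ∇ (c • φ : 𝓓(Ω, ℝ)) = c • ∇ (φ : E → ℝ) := by
  ext1 x
  have : fderiv ℝ (c • φ : 𝓓(Ω, ℝ)) x = c • fderiv ℝ φ x :=
    fderiv_const_smul φ.differentiable.differentiableAt c
  rw [gradient, this, map_smul]
  rfl

theorem continuous_gradient_testFunction (φ : 𝓓(Ω, ℝ)) : Continuous (∇ (φ : E → ℝ)) :=
  (InnerProductSpace.toDual ℝ E).symm.continuous.comp (φ.contDiff.continuous_fderiv (by simp))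

theorem support_gradient_testFunction_subset (φ : 𝓓(Ω, ℝ)) :
    Function.support (∇ (φ : E → ℝ)) ⊆ tsupport φ := by
  intro x hx
  refine support_fderiv_subset ℝ (f := φ) ?_
  contrapose! hx
  simp only [Function.mem_support, not_not] at hx ⊢
  simp [gradient, hx]

theorem hasCompactSupport_gradient_testFunction (φ : 𝓓(Ω, ℝ)) :
    HasCompactSupport (∇ (φ : E → ℝ)) :=
  φ.hasCompactSupport.mono' (support_gradient_testFunction_subset φ)

theorem gradient_testFunction_eq_zero_of_notMem (φ : 𝓓(Ω, ℝ)) {x : E} (hx : x ∉ Ω) :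
    ∇ (φ : E → ℝ) x = 0 := by
  by_contra h
  exact hx (φ.tsupport_subset (support_gradient_testFunction_subset φ h))

theorem inner_gradient_testFunction (φ : 𝓓(Ω, ℝ)) (x v : E) :
    inner ℝ (∇ (φ : E → ℝ) x) v = fderiv ℝ φ x v := by
  simp [gradient]

variable [MeasurableSpace E] [BorelSpace E]

omit [CompleteSpace E] in
theorem memLp_testFunction (φ : 𝓓(Ω, ℝ)) (p : ℝ≥0∞) (μ : Measure E)
    [IsFiniteMeasureOnCompacts μ] : MemLp φ p μ :=
  φ.continuous.memLp_of_hasCompactSupport φ.hasCompactSupport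

theorem memLp_gradient_testFunction (φ : 𝓓(Ω, ℝ)) (p : ℝ≥0∞) (μ : Measure E)
    [IsFiniteMeasureOnCompacts μ] : MemLp (∇ (φ : E → ℝ)) p μ :=
  (continuous_gradient_testFunction φ).memLp_of_hasCompactSupport
    (hasCompactSupport_gradient_testFunction φ)

variable (Ω) in
/-- A test function, as an element of `L²(μ)`. -/
noncomputable def testFunctionToL2 (μ : Measure E) [IsFiniteMeasureOnCompacts μ] :
    𝓓(Ω, ℝ) →ₗ[ℝ] Lp ℝ 2 μ where
  toFun φ := (memLp_testFunction φ 2 μ).toLp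
  map_add' φ ψ := MemLp.toLp_add (memLp_testFunction φ 2 μ) (memLp_testFunction ψ 2 μ)
  map_smul' c φ := MemLp.toLp_const_smul c (memLp_testFunction φ 2 μ)

variable (Ω) in
/-- The gradient of a test function, as an element of `L²(μ; E)`. -/
noncomputable def gradientToL2 (μ : Measure E) [IsFiniteMeasureOnCompacts μ] :
    𝓓(Ω, ℝ) →ₗ[ℝ] Lp E 2 μ where
  toFun φ := (memLp_gradient_testFunction φ 2 μ).toLp
  map_add' φ ψ := by
    rw [← MemLp.toLp_add]
    congr 1
    exact gradient_testFunction_add φ ψ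
  map_smul' c φ := by
    rw [RingHom.id_apply, ← MemLp.toLp_const_smul]
    congr 1
    exact gradient_testFunction_smul c φ

omit [CompleteSpace E] in
theorem coeFn_testFunctionToL2 (μ : Measure E) [IsFiniteMeasureOnCompacts μ] (φ : 𝓓(Ω, ℝ)) :
    testFunctionToL2 Ω μ φ =ᵐ[μ] φ :=
  MemLp.coeFn_toLp (memLp_testFunction φ 2 μ)

theorem coeFn_gradientToL2 (μ : Measure E) [IsFiniteMeasureOnCompacts μ] (φ : 𝓓(Ω, ℝ)) :
    gradientToL2 Ω μ φ =ᵐ[μ] ∇ (φ : E → ℝ) :=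
  MemLp.coeFn_toLp (memLp_gradient_testFunction φ 2 μ)

end TestFunctions

/-! ### Integration against a vector measure with density -/

section IntegralOfDensity

variable {X E F G : Type*} {mX : MeasurableSpace X} {μ : Measure X}
  [NormedAddCommGroup E] [NormedSpace ℝ E] [NormedAddCommGroup F] [NormedSpace ℝ F]
  [CompleteSpace F] [NormedAddCommGroup G] [NormedSpace ℝ G]

/-- If `f` is integrable for the variation `‖g‖ μ` of the vector measure `g μ`, then its pairing
with `g` is `μ`-integrable, even though `f` need not be measurable where `g` vanishes. -/
theorem integrable_bilin_of_integrable_variation {f : X → E} {g : X → F} (hg : Integrable g μ)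
    (hf : Integrable f (μ.withDensityᵥ g).variation) (B : E →L[ℝ] F →L[ℝ] G) :
    Integrable (fun x ↦ B (f x) (g x)) μ := by
  rw [Measure.variation_withDensityᵥ hg] at hf
  obtain ⟨f', hf'm, hff'⟩ := hf.1
  have hae : ∀ᵐ x ∂μ, B (f x) (g x) = B (f' x) (g x) := by
    have := (ae_withDensity_iff' hg.1.enorm).1 hff'
    filter_upwards [this] with x hx
    by_cases h0 : g x = 0
    · simp [h0]
    · rw [hx (by simpa using h0)]
  have hf' : Integrable f' (μ.withDensity fun x ↦ ‖g x‖ₑ) := hf.congr hff'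
  refine Integrable.congr (f := fun x ↦ B (f' x) (g x)) ⟨?_, ?_⟩ (hae.mono fun x hx ↦ hx.symm)
  · exact (B.aestronglyMeasurable_comp₂ hf'm.aestronglyMeasurable hg.1)
  · have h2 := hf'.2
    rw [hasFiniteIntegral_iff_enorm] at h2 ⊢
    rw [lintegral_withDensity_eq_lintegral_mul₀ hg.1.enorm hf'm.enorm.aemeasurable] at h2
    calc ∫⁻ x, ‖B (f' x) (g x)‖ₑ ∂μ
        ≤ ∫⁻ x, ‖B‖ₑ * (‖g x‖ₑ * ‖f' x‖ₑ) ∂μ := by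
          refine lintegral_mono fun x ↦ ?_
          refine (B.le_opENorm₂ (f' x) (g x)).trans_eq ?_
          ring
      _ = ‖B‖ₑ * ∫⁻ x, ‖g x‖ₑ * ‖f' x‖ₑ ∂μ := lintegral_const_mul' _ _ enorm_ne_top
      _ < ∞ := ENNReal.mul_lt_top enorm_lt_top h2

/-- Integration against the vector measure with density `g` with respect to `μ`. -/
theorem integral_withDensityᵥ [CompleteSpace G] {f : X → E} {g : X → F} (hg : Integrable g μ)
    (hf : Integrable f (μ.withDensityᵥ g).variation) (B : E →L[ℝ] F →L[ℝ] G) :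
    (μ.withDensityᵥ g).integral f B = ∫ x, B (f x) (g x) ∂μ := by
  have hvar := Measure.variation_withDensityᵥ hg
  have bound : ∀ f : X → E, Integrable f (μ.withDensityᵥ g).variation →
      ‖∫ x, B (f x) (g x) ∂μ‖ₑ ≤ ‖B‖ₑ * ∫⁻ x, ‖f x‖ₑ ∂(μ.withDensityᵥ g).variation := by
    intro f hf
    refine (enorm_integral_le_lintegral_enorm _).trans ?_
    rw [hvar, lintegral_withDensity_eq_lintegral_mul₀' hg.1.enorm (hvar ▸ hf.1.enorm),
      ← lintegral_const_mul' _ _ enorm_ne_top]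
    refine lintegral_mono fun x ↦ (B.le_opENorm₂ (f x) (g x)).trans_eq ?_
    simp only [Pi.mul_apply]
    ring
  have hcont : Continuous fun f : X →₁[(μ.withDensityᵥ g).variation] E ↦
      ∫ x, B (f x) (g x) ∂μ := by
    refine LipschitzWith.continuous (K := ‖B‖₊) fun f f' ↦ ?_
    have hi := fun f : X →₁[(μ.withDensityᵥ g).variation] E ↦
      integrable_bilin_of_integrable_variation hg (L1.integrable_coeFn f) B
    rw [edist_eq_enorm_sub, ← integral_sub (hi f) (hi f'), L1.edist_def]
    have := bound (fun x ↦ f x - f' x) ((L1.integrable_coeFn f).sub (L1.integrable_coeFn f'))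
    simpa [edist_eq_enorm_sub, enorm_eq_nnnorm] using this
  have hfin : IsFiniteMeasure (μ.withDensityᵥ g).variation := by
    rw [hvar]
    exact isFiniteMeasure_withDensity hg.2.ne
  refine Integrable.induction (P := fun f ↦ (μ.withDensityᵥ g).integral f B =
    ∫ x, B (f x) (g x) ∂μ) (fun c s hs _ ↦ ?_) (fun f f' _ hf hf' h1 h2 ↦ ?_)
    (isClosed_eq VectorMeasure.continuous_integral hcont) (fun f f' h hf ih ↦ ?_) hf
  · rw [VectorMeasure.integral_indicator_const c hs, withDensityᵥ_apply hg hs,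
      ← (B c).integral_comp_comm hg.integrableOn, ← integral_indicator hs]
    congr 1
    ext x
    by_cases hx : x ∈ s <;> simp [hx]
  · rw [VectorMeasure.integral_add hf hf', h1, h2,
      ← integral_add (integrable_bilin_of_integrable_variation hg hf B)
        (integrable_bilin_of_integrable_variation hg hf' B)]
    simp
  · rw [← VectorMeasure.integral_congr_ae h, ih]
    rw [hvar] at h
    refine integral_congr_ae ?_
    filter_upwards [(ae_withDensity_iff' hg.1.enorm).1 h] with x hx
    by_cases h0 : g x = 0
    · simp [h0]
    · rw [hx (by simpa using h0)]

end IntegralOfDensity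

/-! ### Functionals of the gradient as vector measures -/

section Representation

open scoped CompactlySupported

/-- A linear functional on test functions which is dominated by the supremum norm of the gradient
is dominated by the `L¹(ν)` norm of the gradient, for some measure `ν` of mass at most `1`. -/
theorem exists_measure_le_integral_norm_gradient {E : Type*} [NormedAddCommGroup E]
    [InnerProductSpace ℝ E] [FiniteDimensional ℝ E] [CompleteSpace E] [MeasurableSpace E]
    [BorelSpace E]
    {Ω : Opens E} (l : 𝓓(Ω, ℝ) →ₗ[ℝ] ℝ)
    (h : ∀ (φ : 𝓓(Ω, ℝ)) (C : ℝ), (∀ x, ‖∇ (φ : E → ℝ) x‖ ≤ C) → l φ ≤ C) :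
    ∃ ν : Measure E, ν univ ≤ 1 ∧ ∀ φ : 𝓓(Ω, ℝ), l φ ≤ ∫ x, ‖∇ (φ : E → ℝ) x‖ ∂ν := by
  have : ProperSpace E := FiniteDimensional.proper ℝ E
  let A : 𝓓(Ω, ℝ) → C_c(E, ℝ) := fun φ ↦
    ⟨⟨fun x ↦ ‖∇ (φ : E → ℝ) x‖, (continuous_gradient_testFunction φ).norm⟩,
      (hasCompactSupport_gradient_testFunction φ).norm⟩
  have A_apply : ∀ φ x, A φ x = ‖∇ (φ : E → ℝ) x‖ := fun φ x ↦ rfl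
  -- the sublinear functional is the supremum of the positive part
  let N : C_c(E, ℝ) → ℝ := fun f ↦ ⨆ x, max (f x) 0
  have bdd : ∀ f : C_c(E, ℝ), BddAbove (range fun x ↦ max (f x) 0) := fun f ↦ by
    obtain ⟨C, hC⟩ := f.hasCompactSupport.exists_bound_of_continuous f.continuous
    refine ⟨C, ?_⟩
    rintro _ ⟨x, rfl⟩
    exact max_le ((le_abs_self _).trans (hC x)) ((norm_nonneg _).trans (hC x))
  have le_N : ∀ f x, f x ≤ N f := fun f x ↦ (le_max_left _ _).trans (le_ciSup (bdd f) x)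
  have N_nonneg : ∀ f, 0 ≤ N f := fun f ↦ (le_max_right _ _).trans (le_ciSup (bdd f) 0)
  have N_le : ∀ (f : C_c(E, ℝ)) (C : ℝ), 0 ≤ C → (∀ x, f x ≤ C) → N f ≤ C := fun f C hC hf ↦
    ciSup_le fun x ↦ max_le (hf x) hC
  obtain ⟨Λ, hΛN, hΛl⟩ := exists_linearMap_le_of_le_sublinear_comp l A N
    (by
      intro c hc f
      simp only [N]
      rw [Real.mul_iSup_of_nonneg hc.le]
      congr 1
      ext x
      rw [mul_max_of_nonneg _ _ hc.le, mul_zero]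
      rfl)
    (by
      intro f g
      refine N_le _ _ (add_nonneg (N_nonneg f) (N_nonneg g)) fun x ↦ ?_
      exact add_le_add (le_N f x) (le_N g x))
    (by
      ext x
      have := gradient_testFunction_smul 0 (0 : 𝓓(Ω, ℝ))
      rw [zero_smul, zero_smul] at this
      rw [A_apply, this]
      simp)
    (by
      intro c hc φ
      ext x
      rw [A_apply, gradient_testFunction_smul, Pi.smul_apply, norm_smul, Real.norm_of_nonneg hc.le]
      rfl)
    (by
      intro f φ ψ
      refine N_le _ _ (N_nonneg _) fun x ↦ le_trans ?_ (le_N _ x)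
      change f x + A (φ + ψ) x ≤ f x + (A φ x + A ψ x)
      simp only [A_apply, gradient_testFunction_add, Pi.add_apply]
      gcongr
      exact norm_add_le _ _)
    (fun φ ↦ h φ _ fun x ↦ le_N (A φ) x)
  let Λ' : C_c(E, ℝ) →ₚ[ℝ] ℝ := PositiveLinearMap.mk₀ Λ fun f hf ↦ by
    have h1 := (hΛN (-f)).trans (N_le (-f) 0 le_rfl fun x ↦ neg_nonpos.2 (hf x))
    rw [map_neg] at h1
    linarith
  refine ⟨RealRMK.rieszMeasure Λ', ?_, fun φ ↦ ?_⟩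
  · rw [isOpen_univ.measure_eq_iSup_isCompact]
    refine iSup_le fun K ↦ iSup_le fun _ ↦ iSup_le fun hK ↦ ?_
    obtain ⟨f, hf1, -, hfc, hf01⟩ := exists_continuous_one_zero_of_isCompact hK isClosed_empty
      (disjoint_empty K)
    refine (RealRMK.rieszMeasure_le_of_eq_one Λ' (f := ⟨f, hfc⟩) (fun x ↦ (hf01 x).1) hK
      hf1).trans ?_
    rw [ENNReal.ofReal_le_one]
    exact (hΛN _).trans (N_le _ 1 zero_le_one fun x ↦ (hf01 x).2)
  · have := RealRMK.integral_rieszMeasure Λ' (A φ)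
    exact (hΛl φ).trans_eq this.symm

/-- A linear functional on test functions which is dominated by the supremum norm of the gradient
is `φ ↦ ∫ σ · ∇φ dν` for a density `σ` of `L¹(ν)` norm at most `1`. -/
theorem exists_density_integral_inner_gradient {E : Type*} [NormedAddCommGroup E]
    [InnerProductSpace ℝ E] [FiniteDimensional ℝ E] [CompleteSpace E] [MeasurableSpace E]
    [BorelSpace E]
    {Ω : Opens E} (l : 𝓓(Ω, ℝ) →ₗ[ℝ] ℝ)
    (h : ∀ (φ : 𝓓(Ω, ℝ)) (C : ℝ), (∀ x, ‖∇ (φ : E → ℝ) x‖ ≤ C) → l φ ≤ C) :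
    ∃ (ν : Measure E) (σ : E → E), IsFiniteMeasure ν ∧ Integrable σ ν ∧ ∫⁻ x, ‖σ x‖ₑ ∂ν ≤ 1 ∧
      ∀ φ : 𝓓(Ω, ℝ), ∫ x, inner ℝ (∇ (φ : E → ℝ) x) (σ x) ∂ν = l φ := by
  obtain ⟨ν, hν, hl⟩ := exists_measure_le_integral_norm_gradient l h
  have : IsFiniteMeasure ν := ⟨hν.trans_lt ENNReal.one_lt_top⟩
  have hint : ∀ f : Lp E 2 ν, Integrable f ν := fun f ↦ (Lp.memLp f).integrable one_le_two
  obtain ⟨σ, hσN, hσl⟩ := exists_inner_eq_of_le_sublinear_comp l (gradientToL2 Ω ν)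
    (fun f ↦ ∫ x, ‖f x‖ ∂ν)
    (by
      intro c hc f
      rw [← integral_const_mul]
      refine integral_congr_ae ?_
      filter_upwards [Lp.coeFn_smul c f] with x hx
      rw [hx, Pi.smul_apply, norm_smul, Real.norm_of_nonneg hc.le])
    (by
      intro f g
      rw [← integral_add (hint f).norm (hint g).norm]
      refine integral_mono_ae (hint _).norm ((hint f).norm.add (hint g).norm) ?_
      filter_upwards [Lp.coeFn_add f g] with x hx
      rw [hx]
      exact norm_add_le _ _)
    1
    (by
      intro f
      rw [one_mul, integral_norm_eq_lintegral_enorm (hint f).1, Lp.norm_def,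
        ← eLpNorm_one_eq_lintegral_enorm]
      refine ENNReal.toReal_mono (Lp.eLpNorm_ne_top f) ?_
      refine (eLpNorm_le_eLpNorm_mul_rpow_measure_univ one_le_two (hint f).1).trans ?_
      refine mul_le_of_le_one_right' (ENNReal.rpow_le_one hν ?_)
      norm_num)
    (by
      intro φ
      refine (hl φ).trans_eq (integral_congr_ae ?_)
      filter_upwards [coeFn_gradientToL2 ν φ] with x hx
      rw [hx])
  refine ⟨ν, σ, this, hint σ, ?_, fun φ ↦ ?_⟩
  · -- test the bound `⟪σ, f⟫ ≤ ∫ ‖f‖` with the direction field `f = σ / ‖σ‖`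
    have hs : AEStronglyMeasurable (fun x ↦ ‖σ x‖⁻¹ • σ x) ν :=
      (hint σ).1.norm.aemeasurable.inv.aestronglyMeasurable.smul (hint σ).1
    have hs1 : ∀ x, ‖‖σ x‖⁻¹ • σ x‖ ≤ 1 := fun x ↦ by
      rw [norm_smul, norm_inv, norm_norm]
      exact inv_mul_le_one
    have hsL : MemLp (fun x ↦ ‖σ x‖⁻¹ • σ x) 2 ν := MemLp.of_bound hs 1 (.of_forall hs1)
    have h1 := hσN (hsL.toLp _)
    have h2 : inner ℝ σ (hsL.toLp _) = ∫ x, ‖σ x‖ ∂ν := by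
      rw [L2.inner_def]
      refine integral_congr_ae ?_
      filter_upwards [hsL.coeFn_toLp] with x hx
      rw [hx, inner_smul_right, real_inner_self_eq_norm_sq]
      by_cases h0 : ‖σ x‖ = 0
      · simp [h0]
      · field_simp
    have h3 : ∫ x, ‖hsL.toLp _ x‖ ∂ν ≤ ∫ x, (1 : ℝ) ∂ν := by
      refine integral_mono_ae (hint _).norm (integrable_const _) ?_
      filter_upwards [hsL.coeFn_toLp] with x hx
      rw [hx]
      exact hs1 x
    have h4 : ∫ x, (1 : ℝ) ∂ν ≤ 1 := by
      rw [integral_const, smul_eq_mul, mul_one]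
      exact ENNReal.toReal_le_of_le_ofReal zero_le_one (by simpa using hν)
    have h5 : ∫ x, ‖σ x‖ ∂ν ≤ 1 := by linarith
    rw [← ofReal_integral_norm_eq_lintegral_enorm (hint σ)]
    exact ENNReal.ofReal_le_one.2 h5
  · rw [← hσl φ, L2.inner_def]
    refine integral_congr_ae ?_
    filter_upwards [coeFn_gradientToL2 ν φ] with x hx
    rw [hx, real_inner_comm]

end Representation

/-! ### Weak gradients and the functional `𝒥` -/

section WeakGradient

/-- The gradient of a test function, as a vector-valued test function. -/
noncomputable def gradientTestFunction {E : Type*} [NormedAddCommGroup E] [InnerProductSpace ℝ E]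
    [CompleteSpace E] {Ω : Opens E} (φ : 𝓓(Ω, ℝ)) : 𝓓(Ω, E) where
  toFun := ∇ (φ : E → ℝ)
  contDiff' := by
    have h : ContDiff ℝ (⊤ : ℕ∞) (fderiv ℝ φ) := φ.contDiff.fderiv_right (by simp)
    exact (InnerProductSpace.toDual ℝ E).symm.toContinuousLinearEquiv.contDiff.comp h
  hasCompactSupport' := hasCompactSupport_gradient_testFunction φ
  tsupport_subset' := (closure_minimal (support_gradient_testFunction_subset φ)
    (isClosed_tsupport _)).trans φ.tsupport_subset

variable {n : ℕ} {Ω : Opens (EuclideanSpace ℝ (Fin n))}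
  {u u' : EuclideanSpace ℝ (Fin n) → ℝ}
  {G G' : EuclideanSpace ℝ (Fin n) → EuclideanSpace ℝ (Fin n)}

theorem setIntegral_eq_integral_of_forall_notMem {F : Type*} [NormedAddCommGroup F]
    [NormedSpace ℝ F] {f : EuclideanSpace ℝ (Fin n) → F} (h : ∀ x ∉ Ω, f x = 0) :
    ∫ x in Ω, f x = ∫ x, f x :=
  setIntegral_eq_integral_of_forall_compl_eq_zero h

theorem integrable_smul_gradient_testFunction (hu : LocallyIntegrableOn u Ω) (φ : 𝓓(Ω, ℝ)) :
    Integrable (fun x ↦ u x • ∇ (φ : EuclideanSpace ℝ (Fin n) → ℝ) x) :=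
  TestFunction.integrable_bilin (ContinuousLinearMap.lsmul ℝ ℝ).flip hu (gradientTestFunction φ)

theorem integrable_testFunction_smul (hG : LocallyIntegrableOn G Ω) (φ : 𝓓(Ω, ℝ)) :
    Integrable (fun x ↦ φ x • G x) :=
  TestFunction.integrable_bilin (ContinuousLinearMap.lsmul ℝ ℝ) hG φ

/-- A weak gradient may be tested direction by direction. -/
theorem hasWeakGradient_of_forall_inner (hu : LocallyIntegrableOn u Ω)
    (hG : LocallyIntegrableOn G Ω)
    (h : ∀ (φ : 𝓓(Ω, ℝ)) (v : EuclideanSpace ℝ (Fin n)),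
      ∫ x in Ω, u x * inner ℝ v (∇ (φ : EuclideanSpace ℝ (Fin n) → ℝ) x)
        = - ∫ x in Ω, φ x * inner ℝ v (G x)) :
    HasWeakGradient Ω u G := by
  refine ⟨hu, hG, fun φ ↦ ext_inner_left ℝ fun v ↦ ?_⟩
  rw [inner_neg_right, ← integral_inner (integrable_smul_gradient_testFunction hu φ).integrableOn,
    ← integral_inner (integrable_testFunction_smul hG φ).integrableOn]
  simpa only [inner_smul_right] using h φ v

theorem HasWeakGradient.integral_inner_eq (h : HasWeakGradient Ω u G) (φ : 𝓓(Ω, ℝ))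
    (v : EuclideanSpace ℝ (Fin n)) :
    ∫ x in Ω, u x * inner ℝ v (∇ (φ : EuclideanSpace ℝ (Fin n) → ℝ) x)
      = - ∫ x in Ω, φ x * inner ℝ v (G x) := by
  have hk := congrArg (inner ℝ v) (h.integral_eq φ)
  rw [inner_neg_right,
    ← integral_inner (integrable_smul_gradient_testFunction h.locallyIntegrableOn φ).integrableOn,
    ← integral_inner (integrable_testFunction_smul h.locallyIntegrableOn_grad φ).integrableOn] at hk
  simpa only [inner_smul_right] using hk

theorem locallyIntegrableOn_of_memLp {F : Type*} [NormedAddCommGroup F]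
    {f : EuclideanSpace ℝ (Fin n) → F} {p : ℝ≥0∞} (hf : MemLp f p (lebesgueOn Ω)) (hp : 1 ≤ p) :
    LocallyIntegrableOn f Ω :=
  locallyIntegrableOn_of_locallyIntegrable_restrict (hf.locallyIntegrable hp)

theorem hasWeakGradient_testFunction (ψ : 𝓓(Ω, ℝ)) :
    HasWeakGradient Ω ψ (∇ (ψ : EuclideanSpace ℝ (Fin n) → ℝ)) := by
  refine hasWeakGradient_of_forall_inner
    (locallyIntegrableOn_of_memLp (memLp_testFunction ψ 2 _) one_le_two)
    (locallyIntegrableOn_of_memLp (memLp_gradient_testFunction ψ 2 _) one_le_two)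
    fun φ v ↦ ?_
  rw [setIntegral_eq_integral_of_forall_notMem, setIntegral_eq_integral_of_forall_notMem]
  · have hin : ∀ (φ : 𝓓(Ω, ℝ)) (x : EuclideanSpace ℝ (Fin n)),
        inner ℝ v (∇ (φ : EuclideanSpace ℝ (Fin n) → ℝ) x) = fderiv ℝ φ x v := fun φ x ↦ by
      rw [real_inner_comm, inner_gradient_testFunction]
    simp only [hin]
    have hcd : ∀ φ : 𝓓(Ω, ℝ), Continuous fun x ↦ fderiv ℝ φ x v := fun φ ↦
      (φ.contDiff.continuous_fderiv (by simp)).clm_apply continuous_const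
    rw [integral_mul_fderiv_eq_neg_fderiv_mul_of_integrable]
    · simp only [mul_comm]
    · exact ((hcd ψ).mul φ.continuous).integrable_of_hasCompactSupport φ.hasCompactSupport.mul_left
    · exact (ψ.continuous.mul (hcd φ)).integrable_of_hasCompactSupport ψ.hasCompactSupport.mul_right
    · exact (ψ.continuous.mul φ.continuous).integrable_of_hasCompactSupport
        ψ.hasCompactSupport.mul_right
    · exact fun x _ ↦ ψ.differentiable x
    · exact fun x _ ↦ φ.differentiable x
  · intro x hx
    rw [testFunction_eq_zero_of_notMem φ hx, zero_mul]
  · intro x hx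
    rw [testFunction_eq_zero_of_notMem ψ hx, zero_mul]

theorem HasWeakGradient.ae_eq (h : HasWeakGradient Ω u G) (h' : HasWeakGradient Ω u G') :
    G =ᵐ[lebesgueOn Ω] G' := by
  have := Ω.isOpen.ae_eq_zero_of_integral_contDiff_smul_eq_zero
    (h.locallyIntegrableOn_grad.sub h'.locallyIntegrableOn_grad) (by
      intro g hg hgc hgs
      let φ : 𝓓(Ω, ℝ) := ⟨g, hg, hgc, hgs⟩
      have e1 := h.integral_eq φ
      rw [h'.integral_eq φ, neg_inj, setIntegral_eq_integral_of_forall_notMem,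
        setIntegral_eq_integral_of_forall_notMem] at e1
      · have i1 := integrable_testFunction_smul h.locallyIntegrableOn_grad φ
        have i2 := integrable_testFunction_smul h'.locallyIntegrableOn_grad φ
        have : ∫ x, (g x • G x - g x • G' x) = 0 :=
          (integral_sub i1 i2).trans (sub_eq_zero.2 e1.symm)
        simpa only [Pi.sub_apply, smul_sub] using this
      · intro x hx
        rw [testFunction_eq_zero_of_notMem φ hx, zero_smul]
      · intro x hx
        rw [testFunction_eq_zero_of_notMem φ hx, zero_smul])
  rw [← ae_restrict_iff' Ω.isOpen.measurableSet] at this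
  filter_upwards [this] with x hx
  exact sub_eq_zero.1 hx

theorem HasWeakGradient.congr (h : HasWeakGradient Ω u G) (hu : u =ᵐ[lebesgueOn Ω] u') :
    HasWeakGradient Ω u' G := by
  refine ⟨h.locallyIntegrableOn.congr hu, h.locallyIntegrableOn_grad, fun φ ↦ ?_⟩
  rw [← h.integral_eq φ]
  refine integral_congr_ae ?_
  filter_upwards [hu] with x hx
  rw [hx]

theorem HasWeakGradient.const_smul (h : HasWeakGradient Ω u G) (c : ℝ) :
    HasWeakGradient Ω (c • u) (c • G) := by
  refine ⟨fun x hx ↦ (h.locallyIntegrableOn x hx).smul c,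
    fun x hx ↦ (h.locallyIntegrableOn_grad x hx).smul c, fun φ ↦ ?_⟩
  simp only [Pi.smul_apply, smul_assoc, smul_comm _ c]
  rw [integral_smul, integral_smul, h.integral_eq φ, smul_neg]

theorem MemW1InfZero.congr (h : MemW1InfZero Ω u) (hu : u =ᵐ[lebesgueOn Ω] u') :
    MemW1InfZero Ω u' := by
  obtain ⟨G, hG, hGb⟩ := h.exists_grad
  obtain ⟨w, hwc, hwu, hw0⟩ := h.zero_boundary
  exact ⟨h.memLp.ae_eq hu, ⟨G, hG.congr hu, hGb⟩, ⟨w, hwc, hwu.trans hu, hw0⟩⟩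

theorem MemW1InfZero.const_smul (h : MemW1InfZero Ω u) (c : ℝ) : MemW1InfZero Ω (c • u) := by
  obtain ⟨G, hG, hGb⟩ := h.exists_grad
  obtain ⟨w, hwc, hwu, hw0⟩ := h.zero_boundary
  refine ⟨h.memLp.const_smul c, ⟨c • G, hG.const_smul c, hGb.const_smul c⟩,
    ⟨c • w, hwc.const_smul c, hwu.const_smul c, fun _ hx ↦ ?_⟩⟩
  rw [Pi.smul_apply, hw0 _ hx, smul_zero]

theorem memW1InfZero_testFunction (φ : 𝓓(Ω, ℝ)) : MemW1InfZero Ω φ where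
  memLp := memLp_testFunction φ _ _
  exists_grad := ⟨_, hasWeakGradient_testFunction φ, memLp_gradient_testFunction φ _ _⟩
  zero_boundary := ⟨φ, φ.continuous.continuousOn, .rfl, fun _ hx ↦
    testFunction_eq_zero_of_notMem φ fun h ↦ (Ω.isOpen.frontier_eq ▸ hx).2 h⟩

theorem hasWeakGradient_weakGradient (h : ∃ G, HasWeakGradient Ω u G) :
    HasWeakGradient Ω u (weakGradient Ω u) := by
  rw [weakGradient, dif_pos h]
  exact h.choose_spec

/-- `𝒥` may be computed from any representative of the function and of its weak gradient. -/
theorem functionalJ_eq_eLpNorm (hu : MemW1InfZero Ω u) (hG : HasWeakGradient Ω u G) {v : L2 Ω}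
    (hv : v =ᵐ[lebesgueOn Ω] u) :
    functionalJ Ω v = ((eLpNorm G ∞ (lebesgueOn Ω) : ℝ≥0∞) : EReal) := by
  rw [functionalJ, if_pos (hu.congr hv.symm)]
  congr 1
  have hG' := hG.congr hv.symm
  exact eLpNorm_congr_ae ((hasWeakGradient_weakGradient ⟨G, hG'⟩).ae_eq hG')

theorem functionalJ_zero : functionalJ Ω 0 = 0 := by
  have h := functionalJ_eq_eLpNorm (memW1InfZero_testFunction (0 : 𝓓(Ω, ℝ)))
    ((hasWeakGradient_testFunction (0 : 𝓓(Ω, ℝ))).const_smul 0 |>.congr (by simp))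
    (v := 0) (Lp.coeFn_zero _ _ _)
  rw [h, zero_smul]
  simp

theorem functionalJ_smul {v : L2 Ω} (hv : MemW1InfZero Ω v) {c : ℝ} (hc : 0 ≤ c) :
    functionalJ Ω (c • v) = (c : EReal) * functionalJ Ω v := by
  obtain ⟨G, hG, -⟩ := hv.exists_grad
  rw [functionalJ_eq_eLpNorm hv hG .rfl,
    functionalJ_eq_eLpNorm (hv.const_smul c) (hG.const_smul c) (Lp.coeFn_smul c v),
    eLpNorm_const_smul, EReal.coe_ennreal_mul, Real.enorm_of_nonneg hc, EReal.coe_ennreal_ofReal,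
    max_eq_left hc]

theorem functionalJ_testFunction_le (φ : 𝓓(Ω, ℝ)) {C : ℝ}
    (h : ∀ x, ‖∇ (φ : EuclideanSpace ℝ (Fin n) → ℝ) x‖ ≤ C) (hC : 0 ≤ C) :
    functionalJ Ω (testFunctionToL2 Ω _ φ) ≤ C := by
  rw [functionalJ_eq_eLpNorm (memW1InfZero_testFunction φ) (hasWeakGradient_testFunction φ)
    (coeFn_testFunctionToL2 _ φ), ← max_eq_left hC, ← EReal.coe_ennreal_ofReal,
    EReal.coe_ennreal_le_coe_ennreal_iff, eLpNorm_exponent_top]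
  exact eLpNormEssSup_le_of_ae_bound (.of_forall h)

/-- Weak gradients pass to limits in `L²(Ω)`. -/
theorem hasWeakGradient_of_tendsto {ψ : ℕ → 𝓓(Ω, ℝ)} {φ : L2 Ω}
    {g : Lp (EuclideanSpace ℝ (Fin n)) 2 (lebesgueOn Ω)}
    (h : Tendsto (fun k ↦ testFunctionToL2 Ω (lebesgueOn Ω) (ψ k)) atTop (𝓝 φ))
    (hg : Tendsto (fun k ↦ gradientToL2 Ω (lebesgueOn Ω) (ψ k)) atTop (𝓝 g)) :
    HasWeakGradient Ω φ g := by
  refine hasWeakGradient_of_forall_inner (locallyIntegrableOn_of_memLp (Lp.memLp φ) one_le_two)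
    (locallyIntegrableOn_of_memLp (Lp.memLp g) one_le_two) fun χ v ↦ ?_
  have m1 : MemLp (fun x ↦ inner ℝ v (∇ (χ : EuclideanSpace ℝ (Fin n) → ℝ) x)) 2 (lebesgueOn Ω) :=
    (memLp_gradient_testFunction χ 2 _).const_inner v
  have m2 : MemLp (fun x ↦ χ x • v) 2 (lebesgueOn Ω) :=
    ((ContinuousLinearMap.toSpanSingleton ℝ v).comp_memLp' (memLp_testFunction χ 2 (lebesgueOn Ω)) :)
  have e1 : ∀ f : L2 Ω, inner ℝ (m1.toLp _) f =
      ∫ x in Ω, f x * inner ℝ v (∇ (χ : EuclideanSpace ℝ (Fin n) → ℝ) x) := fun f ↦ by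
    rw [L2.inner_def]
    refine integral_congr_ae ?_
    filter_upwards [m1.coeFn_toLp] with x hx
    rw [hx]
    simp
  have e2 : ∀ f : Lp (EuclideanSpace ℝ (Fin n)) 2 (lebesgueOn Ω), inner ℝ (m2.toLp _) f =
      ∫ x in Ω, χ x * inner ℝ v (f x) := fun f ↦ by
    rw [L2.inner_def]
    refine integral_congr_ae ?_
    filter_upwards [m2.coeFn_toLp] with x hx
    rw [hx, real_inner_smul_left]
  rw [← e1, ← e2]
  refine tendsto_nhds_unique (tendsto_const_nhds.inner h) ?_
  refine (tendsto_const_nhds.inner hg).neg.congr fun k ↦ ?_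
  have hk := (hasWeakGradient_testFunction (ψ k)).integral_inner_eq χ v
  rw [e1, e2]
  refine Eq.trans ?_ (hk.symm.trans ?_)
  · congr 1
    refine integral_congr_ae ?_
    filter_upwards [coeFn_gradientToL2 (lebesgueOn Ω) (ψ k)] with x hx
    rw [hx]
  · refine integral_congr_ae ?_
    filter_upwards [coeFn_testFunctionToL2 (lebesgueOn Ω) (ψ k)] with x hx
    rw [hx]

end WeakGradient

/-! ### Poincaré's inequality and the Poisson equation -/

section Poisson

variable {n : ℕ} {Ω : Opens (EuclideanSpace ℝ (Fin n))}

theorem norm_testFunctionToL2_sq (ψ : 𝓓(Ω, ℝ)) :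
    ‖testFunctionToL2 Ω (lebesgueOn Ω) ψ‖ ^ 2 = ∫ x, ψ x ^ 2 := by
  rw [← real_inner_self_eq_norm_sq, L2.inner_def, ← setIntegral_eq_integral_of_forall_notMem]
  · refine integral_congr_ae ?_
    filter_upwards [coeFn_testFunctionToL2 (lebesgueOn Ω) ψ] with x hx
    rw [hx, real_inner_self_eq_norm_sq, Real.norm_eq_abs, sq_abs]
  · intro x hx
    rw [testFunction_eq_zero_of_notMem ψ hx, sq, zero_mul]

theorem norm_gradientToL2_sq (ψ : 𝓓(Ω, ℝ)) :
    ‖gradientToL2 Ω (lebesgueOn Ω) ψ‖ ^ 2 =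
      ∫ x, ‖∇ (ψ : EuclideanSpace ℝ (Fin n) → ℝ) x‖ ^ 2 := by
  rw [← real_inner_self_eq_norm_sq, L2.inner_def, ← setIntegral_eq_integral_of_forall_notMem]
  · refine integral_congr_ae ?_
    filter_upwards [coeFn_gradientToL2 (lebesgueOn Ω) ψ] with x hx
    rw [hx, real_inner_self_eq_norm_sq]
  · intro x hx
    rw [gradient_testFunction_eq_zero_of_notMem ψ hx, norm_zero, sq, zero_mul]

/-- **Poincaré inequality** on a bounded open set. For a unit vector `v`, integration by parts
against the function `x ↦ ⟪v, x⟫` gives `∫ ψ² = - ∫ 2 ψ ∂ᵥψ ⟪v, x⟫`. -/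
theorem norm_testFunctionToL2_le (hn : n ≠ 0) {R : ℝ} (hR : ∀ x ∈ Ω, ‖x‖ ≤ R) (ψ : 𝓓(Ω, ℝ)) :
    ‖testFunctionToL2 Ω (lebesgueOn Ω) ψ‖ ≤ 2 * |R| * ‖gradientToL2 Ω (lebesgueOn Ω) ψ‖ := by
  refine abs_le_of_sq_le_sq' ?_ (by positivity) |>.2
  rw [mul_pow, norm_testFunctionToL2_sq, norm_gradientToL2_sq]
  let v : EuclideanSpace ℝ (Fin n) := EuclideanSpace.single ⟨0, Nat.pos_of_ne_zero hn⟩ 1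
  have hv : ‖v‖ = 1 := by simp [v]
  have hdψ : ∀ x, HasFDerivAt (fun x ↦ ψ x ^ 2) ((2 * ψ x) • fderiv ℝ ψ x) x := fun x ↦ by
    simpa using (ψ.differentiable x).hasFDerivAt.pow 2
  have hdv : ∀ x, HasFDerivAt (fun x : EuclideanSpace ℝ (Fin n) ↦ (inner ℝ v x : ℝ))
      (innerSL ℝ v) x := fun x ↦ (innerSL ℝ v).hasFDerivAt
  have hc : Continuous fun x ↦ fderiv ℝ ψ x v :=
    (ψ.contDiff.continuous_fderiv (by simp)).clm_apply continuous_const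
  have hcv : Continuous fun x : EuclideanSpace ℝ (Fin n) ↦ (inner ℝ v x : ℝ) := by fun_prop
  have hi2 : Integrable (fun x ↦ ψ x ^ 2) := (ψ.continuous.pow 2).integrable_of_hasCompactSupport
    (by simpa only [sq] using! ψ.hasCompactSupport.mul_left)
  have hig : Integrable (fun x ↦ ‖∇ (ψ : EuclideanSpace ℝ (Fin n) → ℝ) x‖ ^ 2) :=
    ((continuous_gradient_testFunction ψ).norm.pow 2).integrable_of_hasCompactSupport
      (by simpa only [sq] using! (hasCompactSupport_gradient_testFunction ψ).norm.mul_left)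
  have hip : Integrable (fun x ↦ 2 * ψ x * fderiv ℝ ψ x v * inner ℝ v x) := by
    refine (((continuous_const.mul ψ.continuous).mul hc).mul hcv).integrable_of_hasCompactSupport ?_
    exact (ψ.hasCompactSupport.mul_left.mul_right).mul_right
  have hparts : ∫ x, ψ x ^ 2 = - ∫ x, 2 * ψ x * fderiv ℝ ψ x v * inner ℝ v x := by
    have := integral_mul_fderiv_eq_neg_fderiv_mul_of_integrable (μ := volume)
      (f := fun x ↦ ψ x ^ 2) (g := fun x : EuclideanSpace ℝ (Fin n) ↦ (inner ℝ v x : ℝ)) (v := v)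
      (by simpa only [(hdψ _).fderiv, smul_apply, smul_eq_mul] using hip)
      (by simpa [(hdv _).fderiv, hv] using hi2)
      ((ψ.continuous.pow 2).mul hcv |>.integrable_of_hasCompactSupport
        (by simpa only [sq] using! ψ.hasCompactSupport.mul_left.mul_right))
      (fun x _ ↦ (hdψ x).differentiableAt) (fun x _ ↦ (hdv x).differentiableAt)
    simpa [(hdv _).fderiv, (hdψ _).fderiv, hv] using this
  have hle : ∫ x, ψ x ^ 2 ≤ ∫ x, (1 / 2 * ψ x ^ 2 +
      2 * |R| ^ 2 * ‖∇ (ψ : EuclideanSpace ℝ (Fin n) → ℝ) x‖ ^ 2) := by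
    rw [hparts, ← integral_neg]
    refine integral_mono hip.neg ((hi2.const_mul _).add (hig.const_mul _)) fun x ↦ ?_
    by_cases hx : x ∈ Ω
    · have h1 : |fderiv ℝ ψ x v| ≤ ‖∇ (ψ : EuclideanSpace ℝ (Fin n) → ℝ) x‖ := by
        rw [← inner_gradient_testFunction]
        simpa [hv] using abs_real_inner_le_norm (∇ (ψ : EuclideanSpace ℝ (Fin n) → ℝ) x) v
      have h2 : |inner ℝ v x| ≤ |R| := by
        refine (abs_real_inner_le_norm v x).trans ?_
        rw [hv, one_mul]
        exact (hR x hx).trans (le_abs_self R)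
      have h3 : |fderiv ℝ ψ x v * inner ℝ v x| ≤
          ‖∇ (ψ : EuclideanSpace ℝ (Fin n) → ℝ) x‖ * |R| := by
        rw [abs_mul]
        gcongr
      have h4 := sq_le_sq' (abs_le.1 h3).1 (abs_le.1 h3).2
      rw [mul_pow] at h4
      simp only
      nlinarith [sq_nonneg (ψ x + 2 * (fderiv ℝ ψ x v * inner ℝ v x))]
    · simp only [testFunction_eq_zero_of_notMem ψ hx]
      ring_nf
      positivity
  rw [integral_add (hi2.const_mul _) (hig.const_mul _), integral_const_mul,
    integral_const_mul] at hle
  linarith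

theorem tendsto_eLpNorm_sub_of_tendsto {F : Type*} [NormedAddCommGroup F]
    {X : Type*} {mX : MeasurableSpace X} {μ : Measure X} {p : ℝ≥0∞} [Fact (1 ≤ p)]
    {f : ℕ → Lp F p μ} {g : Lp F p μ} {f' : ℕ → X → F} (h : Tendsto f atTop (𝓝 g))
    (hf : ∀ k, f k =ᵐ[μ] f' k) :
    Tendsto (fun k ↦ eLpNorm (fun x ↦ f' k x - g x) p μ) atTop (𝓝 0) := by
  refine (tendsto_iff_edist_tendsto_0.1 h).congr fun k ↦ ?_
  rw [Lp.edist_def]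
  refine eLpNorm_congr_ae ?_
  filter_upwards [hf k] with x hx
  simp [hx]

/-- The Poisson equation with right-hand side in `L²(Ω)` and zero boundary values: by Poincaré's
inequality, `ψ ↦ - ∫ D ψ` is a bounded functional of `∇ψ`, so it is represented by an element of
the closure of the gradients of test functions. -/
theorem exists_memG1Zero_hasWeakDivergence (hn : n ≠ 0)
    (hΩ : Bornology.IsBounded (Ω : Set (EuclideanSpace ℝ (Fin n)))) (D : L2 Ω) :
    ∃ g : EuclideanSpace ℝ (Fin n) → EuclideanSpace ℝ (Fin n),
      MemLp g 2 (lebesgueOn Ω) ∧ MemG1Zero Ω g ∧ HasWeakDivergence Ω g D := by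
  obtain ⟨R, hR⟩ := hΩ.exists_norm_le
  set A := gradientToL2 Ω (lebesgueOn Ω)
  set T := testFunctionToL2 Ω (lebesgueOn Ω)
  have hpoinc : ∀ ψ, ‖T ψ‖ ≤ 2 * |R| * ‖A ψ‖ := norm_testFunctionToL2_le hn hR
  let C : ℝ := ‖D‖ * (2 * |R|)
  have hC : 0 ≤ C := by positivity
  obtain ⟨σ, -, hσ⟩ := exists_inner_eq_of_le_sublinear_comp
    (-((innerSL ℝ D).toLinearMap ∘ₗ T)) A (fun f ↦ C * ‖f‖)
    (fun c hc f ↦ by rw [norm_smul, Real.norm_of_nonneg hc.le]; ring)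
    (fun f g ↦ by rw [← mul_add]; gcongr; exact norm_add_le f g)
    C (fun f ↦ le_rfl)
    (fun ψ ↦ by
      have h1 : -inner ℝ D (T ψ) ≤ ‖D‖ * ‖T ψ‖ :=
        (neg_le_abs _).trans (abs_real_inner_le_norm _ _)
      calc -inner ℝ D (T ψ) ≤ ‖D‖ * (2 * |R| * ‖A ψ‖) := h1.trans (by gcongr; exact hpoinc ψ)
        _ = C * ‖A ψ‖ := by simp only [C]; ring)
  let K : Submodule ℝ (Lp (EuclideanSpace ℝ (Fin n)) 2 (lebesgueOn Ω)) :=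
    (LinearMap.range A).topologicalClosure
  let g := K.starProjection σ
  have hg : ∀ ψ, inner ℝ g (A ψ) = -inner ℝ D (T ψ) := fun ψ ↦ by
    have hmem : A ψ ∈ K := Submodule.le_topologicalClosure _ (LinearMap.mem_range_self A ψ)
    rw [Submodule.inner_starProjection_left_eq_right, Submodule.starProjection_eq_self_iff.2 hmem,
      hσ]
    rfl
  have hdiv : HasWeakDivergence Ω g D := by
    refine ⟨locallyIntegrableOn_of_memLp (Lp.memLp g) one_le_two,
      locallyIntegrableOn_of_memLp (Lp.memLp D) one_le_two, fun φ ↦ ?_⟩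
    have h1 := hg φ
    rw [L2.inner_def, L2.inner_def] at h1
    refine Eq.trans (integral_congr_ae ?_) (h1.trans (congrArg _ (integral_congr_ae ?_)))
    · filter_upwards [coeFn_gradientToL2 (lebesgueOn Ω) φ] with x hx
      rw [hx, real_inner_comm]
    · filter_upwards [coeFn_testFunctionToL2 (lebesgueOn Ω) φ] with x hx
      rw [hx]
      simp [mul_comm]
  obtain ⟨s, hs, hsg⟩ := mem_closure_iff_seq_limit.1
    (show g ∈ closure (LinearMap.range A : Set _) from K.starProjection_apply_mem σ)
  choose ψ hψ using hs
  have hAψ : Tendsto (fun k ↦ A (ψ k)) atTop (𝓝 g) := hsg.congr fun k ↦ (hψ k).symm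
  have hcau : CauchySeq fun k ↦ T (ψ k) := by
    refine Metric.cauchySeq_iff.2 fun ε hε ↦ ?_
    obtain ⟨N, hN⟩ := Metric.cauchySeq_iff.1 hAψ.cauchySeq (ε / (2 * |R| + 1)) (by positivity)
    refine ⟨N, fun j hj k hk ↦ ?_⟩
    have h1 := hN j hj k hk
    rw [lt_div_iff₀ (by positivity)] at h1
    rw [dist_eq_norm, ← map_sub] at h1 ⊢
    refine (hpoinc _).trans_lt (lt_of_le_of_lt ?_ h1)
    nlinarith [norm_nonneg (A (ψ j - ψ k))]
  obtain ⟨φ, hφ⟩ := cauchySeq_tendsto_of_complete hcau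
  have hgrad : HasWeakGradient Ω φ g := hasWeakGradient_of_tendsto hφ hAψ
  refine ⟨g, Lp.memLp g, ⟨φ, ⟨Lp.memLp φ, g, hgrad, Lp.memLp g, ψ, ?_, ?_⟩, hgrad, D, Lp.memLp D,
    hdiv⟩, hdiv⟩
  · exact tendsto_eLpNorm_sub_of_tendsto hφ fun k ↦ coeFn_testFunctionToL2 _ _
  · exact tendsto_eLpNorm_sub_of_tendsto hAψ fun k ↦ coeFn_gradientToL2 _ _

theorem memG1Zero_zero : MemG1Zero Ω 0 := by
  have h : HasWeakGradient Ω 0 (0 : EuclideanSpace ℝ (Fin n) → EuclideanSpace ℝ (Fin n)) := by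
    simpa using (hasWeakGradient_testFunction (0 : 𝓓(Ω, ℝ))).const_smul 0
  have h0 : ∀ x, ∇ ((0 : 𝓓(Ω, ℝ)) : EuclideanSpace ℝ (Fin n) → ℝ) x = 0 := fun x ↦ by
    simpa using congrFun (gradient_testFunction_smul 0 (0 : 𝓓(Ω, ℝ))) x
  refine ⟨0, ⟨MemLp.zero, 0, h, MemLp.zero, fun _ ↦ 0, ?_, ?_⟩, h, 0, MemLp.zero, ?_⟩
  · simp
  · simp only [h0]
    simp
  · exact ⟨h.locallyIntegrableOn_grad, h.locallyIntegrableOn, fun φ ↦ by simp⟩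

end Poisson

/-! ### Approximation of `W^{1,∞}_0(Ω)` by test functions -/

section Lipschitz

open ContinuousLinearMap Convolution Metric

variable {n : ℕ} {Ω : Opens (EuclideanSpace ℝ (Fin n))}
  {w : EuclideanSpace ℝ (Fin n) → ℝ}
  {G : EuclideanSpace ℝ (Fin n) → EuclideanSpace ℝ (Fin n)} {L : ℝ}

/-- At points whose `ρ.rOut`-neighbourhood lies in `Ω`, the derivative of the mollification of `w`
is the mollification of the weak gradient, hence satisfies the same bound. -/
theorem HasWeakGradient.exists_hasFDerivAt_convolution (h : HasWeakGradient Ω w G)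
    (hw : LocallyIntegrable ((Ω : Set (EuclideanSpace ℝ (Fin n))).indicator w)) (hL : 0 ≤ L)
    (hGL : ∀ᵐ x ∂lebesgueOn Ω, ‖G x‖ ≤ L) (ρ : ContDiffBump (0 : EuclideanSpace ℝ (Fin n)))
    {y : EuclideanSpace ℝ (Fin n)} (hy : closedBall y ρ.rOut ⊆ Ω) :
    ∃ F' : EuclideanSpace ℝ (Fin n) →L[ℝ] ℝ, ‖F'‖ ≤ L ∧
      HasFDerivAt (ρ.normed volume ⋆[lsmul ℝ ℝ, volume]
        (Ω : Set (EuclideanSpace ℝ (Fin n))).indicator w) F' y := by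
  have hρ1 : ContDiff ℝ 1 (ρ.normed volume) := ρ.contDiff_normed
  have hsupp : ∀ t ∉ closedBall y ρ.rOut, ρ.normed volume (y - t) = 0 := fun t ht ↦ by
    by_contra h0
    have : y - t ∈ Function.support (ρ.normed volume) := h0
    rw [ρ.support_normed_eq, mem_ball_zero_iff, ← dist_eq_norm, dist_comm] at this
    exact ht this.le
  let χ : 𝓓(Ω, ℝ) := ⟨fun t ↦ ρ.normed volume (y - t),
    ρ.contDiff_normed.comp (contDiff_const.sub contDiff_id),
    HasCompactSupport.intro (isCompact_closedBall y ρ.rOut) hsupp,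
    (closure_minimal (Function.support_subset_iff'.2 hsupp) isClosed_closedBall).trans hy⟩
  have hχ : ∀ t, χ t = ρ.normed volume (y - t) := fun t ↦ rfl
  have hdχ : ∀ t v, inner ℝ v (∇ (χ : EuclideanSpace ℝ (Fin n) → ℝ) t) =
      -fderiv ℝ (ρ.normed volume) (y - t) v := fun t v ↦ by
    rw [real_inner_comm, inner_gradient_testFunction]
    have h1 : HasFDerivAt (fun t ↦ ρ.normed volume (y - t)) _ t :=
      ((hρ1.differentiable one_ne_zero) (y - t)).hasFDerivAt.comp t
        ((hasFDerivAt_id t).const_sub y)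
    have h2 : fderiv ℝ χ t = _ := h1.fderiv
    rw [h2]
    simp
  have hderiv := ρ.hasCompactSupport_normed.hasFDerivAt_convolution_right (lsmul ℝ ℝ).flip hw hρ1 y
  rw [convolution_flip] at hderiv
  refine ⟨_, opNorm_le_bound _ hL fun v ↦ ?_, hderiv⟩
  rw [convolution_precompR_apply _ hw (ρ.hasCompactSupport_normed.fderiv ℝ)
    (hρ1.continuous_fderiv one_ne_zero), convolution_def]
  have e1 : ∫ t, (lsmul ℝ ℝ).flip ((Ω : Set (EuclideanSpace ℝ (Fin n))).indicator w t)
      (fderiv ℝ (ρ.normed volume) (y - t) v) = ∫ t in Ω, χ t * inner ℝ v (G t) := by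
    rw [← neg_eq_iff_eq_neg.2 (h.integral_inner_eq χ v), ← integral_neg,
      ← integral_indicator Ω.isOpen.measurableSet]
    congr 1
    ext t
    by_cases ht : t ∈ (Ω : Set (EuclideanSpace ℝ (Fin n)))
    · simp only [indicator_of_mem ht, flip_apply, lsmul_apply, smul_eq_mul, hdχ]
      ring
    · simp only [indicator_of_notMem ht, flip_apply, lsmul_apply, smul_zero]
  have hχi : Integrable χ := χ.continuous.integrable_of_hasCompactSupport χ.hasCompactSupport
  rw [e1]
  calc ‖∫ t in Ω, χ t * inner ℝ v (G t)‖ ≤ ∫ t in Ω, χ t * (L * ‖v‖) := by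
        refine norm_integral_le_of_norm_le (hχi.integrableOn.mul_const _) ?_
        filter_upwards [hGL] with t ht
        have h0 : 0 ≤ χ t := ρ.nonneg_normed _
        rw [norm_mul, Real.norm_of_nonneg h0]
        gcongr
        refine (abs_real_inner_le_norm _ _).trans ?_
        rw [mul_comm]
        gcongr
    _ = L * ‖v‖ := by
        rw [setIntegral_eq_integral_of_forall_notMem, integral_mul_const]
        · simp only [hχ]
          rw [integral_sub_left_eq_self (ρ.normed volume) volume y, ρ.integral_normed, one_mul]
        · intro x hx
          rw [testFunction_eq_zero_of_notMem χ hx, zero_mul]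

theorem HasWeakGradient.abs_sub_le_of_segment_subset (h : HasWeakGradient Ω w G)
    (hw : LocallyIntegrable ((Ω : Set (EuclideanSpace ℝ (Fin n))).indicator w)) (hL : 0 ≤ L)
    (hGL : ∀ᵐ x ∂lebesgueOn Ω, ‖G x‖ ≤ L) (hc : ContinuousOn w Ω)
    {x y : EuclideanSpace ℝ (Fin n)} (hxy : segment ℝ x y ⊆ Ω) :
    |w y - w x| ≤ L * ‖y - x‖ := by
  set f := (Ω : Set (EuclideanSpace ℝ (Fin n))).indicator w
  have hcomp : IsCompact (segment ℝ x y) := by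
    rw [segment_eq_image_lineMap]
    exact isCompact_Icc.image (by fun_prop)
  obtain ⟨δ, hδ, hδΩ⟩ := hcomp.exists_cthickening_subset_open Ω.isOpen hxy
  have hf : ∀ z ∈ Ω, f z = w z := fun z hz ↦ indicator_of_mem (s := (Ω : Set _)) hz w
  have hfc : ∀ z ∈ Ω, ContinuousAt f z := fun z hz ↦ by
    have hnhds : (Ω : Set _) ∈ 𝓝 z := Ω.isOpen.mem_nhds hz
    refine (hc.continuousAt hnhds).congr ?_
    filter_upwards [hnhds] with z hz using (hf z hz).symm
  have hxΩ : x ∈ Ω := hxy (left_mem_segment ℝ x y)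
  have hyΩ : y ∈ Ω := hxy (right_mem_segment ℝ x y)
  refine le_of_forall_pos_le_add fun ε hε ↦ ?_
  obtain ⟨a, ha, hax⟩ := Metric.continuousAt_iff.1 (hfc x hxΩ) (ε / 2) (half_pos hε)
  obtain ⟨b, hb, hby⟩ := Metric.continuousAt_iff.1 (hfc y hyΩ) (ε / 2) (half_pos hε)
  have hr : 0 < min δ (min a b) := lt_min hδ (lt_min ha hb)
  let ρ : ContDiffBump (0 : EuclideanSpace ℝ (Fin n)) :=
    ⟨min δ (min a b) / 2, min δ (min a b), half_pos hr, half_lt_self hr⟩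
  have hx' := ρ.dist_normed_convolution_le (x₀ := x) hw.aestronglyMeasurable
    fun z hz ↦ (hax (lt_of_lt_of_le (mem_ball.1 hz)
      ((min_le_right _ _).trans (min_le_left _ _)))).le
  have hy' := ρ.dist_normed_convolution_le (x₀ := y) hw.aestronglyMeasurable
    fun z hz ↦ (hby (lt_of_lt_of_le (mem_ball.1 hz)
      ((min_le_right _ _).trans (min_le_right _ _)))).le
  have hball : ∀ z ∈ segment ℝ x y, closedBall z ρ.rOut ⊆ Ω := fun z hz ↦
    (closedBall_subset_closedBall (min_le_left _ _)).trans
      ((closedBall_subset_cthickening hz δ).trans hδΩ)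
  choose! F' hF'L hF' using fun z (hz : z ∈ segment ℝ x y) ↦
    h.exists_hasFDerivAt_convolution hw hL hGL ρ (hball z hz)
  have hmv := (convex_segment x y).norm_image_sub_le_of_norm_hasFDerivWithin_le
    (fun z hz ↦ (hF' z hz).hasFDerivWithinAt) hF'L (left_mem_segment ℝ x y)
    (right_mem_segment ℝ x y)
  rw [hf x hxΩ, Real.dist_eq, abs_le] at hx'
  rw [hf y hyΩ, Real.dist_eq, abs_le] at hy'
  rw [Real.norm_eq_abs, abs_le] at hmv
  rw [abs_le]
  constructor <;> linarith [hx'.1, hx'.2, hy'.1, hy'.2, hmv.1, hmv.2]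

/-- A function on `Ω` with zero boundary values and weak gradient bounded by `L` extends by zero to
an `L`-Lipschitz function: a segment leaving `Ω` is cut at a point `z ∉ Ω`, and the values at its
ends are compared with the zero boundary value at the point of `Ωᶜ` nearest to them. -/
theorem HasWeakGradient.lipschitzWith_indicator (h : HasWeakGradient Ω w G)
    (hw : LocallyIntegrable ((Ω : Set (EuclideanSpace ℝ (Fin n))).indicator w)) {L : NNReal}
    (hGL : ∀ᵐ x ∂lebesgueOn Ω, ‖G x‖ ≤ L)
    (hc : ContinuousOn w (closure (Ω : Set (EuclideanSpace ℝ (Fin n)))))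
    (h0 : ∀ x ∈ frontier (Ω : Set (EuclideanSpace ℝ (Fin n))), w x = 0) :
    LipschitzWith L ((Ω : Set (EuclideanSpace ℝ (Fin n))).indicator w) := by
  set f := (Ω : Set (EuclideanSpace ℝ (Fin n))).indicator w
  have hf : ∀ z ∈ Ω, f z = w z := fun z hz ↦ indicator_of_mem (s := (Ω : Set _)) hz w
  have hf0 : ∀ z ∉ Ω, f z = 0 := fun z hz ↦ indicator_of_notMem (s := (Ω : Set _)) hz w
  have hseg : ∀ {x y}, segment ℝ x y ⊆ Ω → |w y - w x| ≤ L * ‖y - x‖ := fun hxy ↦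
    h.abs_sub_le_of_segment_subset hw L.2 hGL (hc.mono subset_closure) hxy
  have hdist : ∀ x, ∀ z ∉ Ω, |f x| ≤ L * dist x z := by
    intro x z hz
    by_cases hx : x ∈ Ω
    swap
    · rw [hf0 x hx, abs_zero]
      positivity
    have hcl : IsClosed (Ω : Set (EuclideanSpace ℝ (Fin n)))ᶜ := Ω.isOpen.isClosed_compl
    obtain ⟨a, haΩ, hda⟩ := hcl.exists_infDist_eq_dist ⟨z, hz⟩ x
    have hpos : 0 < dist x a := dist_pos.2 fun e ↦ haΩ (e ▸ hx)
    -- the points `a + t (x - a)`, `0 < t ≤ 1`, lie in the ball about `x` of radius `dist x a`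
    have hin : ∀ t ∈ Ioc (0 : ℝ) 1, segment ℝ (AffineMap.lineMap a x t) x ⊆ Ω := by
      intro t ht
      have hsub : ball x (dist x a) ⊆ Ω := fun p hp ↦ by
        by_contra hpΩ
        have := infDist_le_dist_of_mem (s := (Ω : Set (EuclideanSpace ℝ (Fin n)))ᶜ) (x := x) hpΩ
        rw [hda, dist_comm x p] at this
        exact absurd hp (not_lt.2 this)
      refine ((convex_ball x (dist x a)).segment_subset ?_ (mem_ball_self hpos)).trans hsub
      rw [mem_ball, dist_lineMap_right, dist_comm a x, Real.norm_of_nonneg (by linarith [ht.2])]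
      nlinarith [ht.1]
    have htend : Tendsto (fun t : ℝ ↦ AffineMap.lineMap a x t) (𝓝[>] 0) (𝓝 a) := by
      have : Continuous fun t : ℝ ↦ (AffineMap.lineMap a x t : EuclideanSpace ℝ (Fin n)) := by
        fun_prop
      simpa using (this.tendsto 0).mono_left nhdsWithin_le_nhds
    have hIoc : Ioc (0 : ℝ) 1 ∈ 𝓝[>] (0 : ℝ) := Ioc_mem_nhdsGT zero_lt_one
    have hmem : ∀ᶠ t in 𝓝[>] (0 : ℝ), AffineMap.lineMap a x t ∈ closure (Ω : Set _) := by
      filter_upwards [hIoc] with t ht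
      exact subset_closure (hin t ht (left_mem_segment ℝ _ _))
    have hacl : a ∈ closure (Ω : Set (EuclideanSpace ℝ (Fin n))) :=
      isClosed_closure.mem_of_tendsto htend hmem
    have hwa : w a = 0 := h0 a (by rw [Ω.isOpen.frontier_eq]; exact ⟨hacl, haΩ⟩)
    have hlim : Tendsto (fun t : ℝ ↦ |w x - w (AffineMap.lineMap a x t)|) (𝓝[>] 0)
        (𝓝 |w x - w a|) :=
      (tendsto_const_nhds.sub ((hc a hacl).tendsto.comp
        (tendsto_nhdsWithin_iff.2 ⟨htend, hmem⟩))).abs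
    have hlim2 : Tendsto (fun t : ℝ ↦ L * ‖x - AffineMap.lineMap a x t‖) (𝓝[>] 0)
        (𝓝 (L * ‖x - a‖)) := (tendsto_const_nhds.sub htend).norm.const_mul _
    have hle := le_of_tendsto_of_tendsto hlim hlim2 (by
      filter_upwards [hIoc] with t ht using hseg (hin t ht))
    rw [hwa, sub_zero, ← dist_eq_norm, ← hda] at hle
    rw [hf x hx]
    refine hle.trans ?_
    gcongr
    exact infDist_le_dist_of_mem hz
  refine LipschitzWith.of_dist_le_mul fun x y ↦ ?_
  by_cases hxy : segment ℝ x y ⊆ Ω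
  · rw [Real.dist_eq, abs_sub_comm, dist_comm, dist_eq_norm, hf x (hxy (left_mem_segment ℝ x y)),
      hf y (hxy (right_mem_segment ℝ x y))]
    exact hseg hxy
  · obtain ⟨z, hz, hzΩ⟩ := not_subset.1 hxy
    have h1 := hdist x z hzΩ
    have h2 := hdist y z hzΩ
    have h3 := dist_add_dist_of_mem_segment hz
    rw [dist_comm z y] at h3
    calc dist (f x) (f y) ≤ |f x| + |f y| := by
          rw [Real.dist_eq]
          exact abs_sub _ _
      _ ≤ L * dist x z + L * dist y z := add_le_add h1 h2
      _ = L * dist x y := by rw [← mul_add, h3]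

/-- Soft thresholding, which moves every number towards `0` by at most `η`. -/
def softThreshold (η t : ℝ) : ℝ := max (t - η) 0 + min (t + η) 0

theorem lipschitzWith_softThreshold {η : ℝ} (hη : 0 ≤ η) : LipschitzWith 1 (softThreshold η) := by
  refine LipschitzWith.of_le_add fun s t ↦ ?_
  rw [Real.dist_eq]
  unfold softThreshold
  rcases le_total s t with hst | hst
  · rw [abs_of_nonpos (by linarith)]
    have h1 : max (s - η) 0 ≤ max (t - η) 0 := max_le_max (by linarith) le_rfl
    have h2 : min (s + η) 0 ≤ min (t + η) 0 := min_le_min (by linarith) le_rfl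
    linarith
  · rw [abs_of_nonneg (by linarith)]
    rcases max_cases (s - η) 0 with h1 | h1 <;> rcases max_cases (t - η) 0 with h2 | h2 <;>
      rcases min_cases (s + η) 0 with h3 | h3 <;> rcases min_cases (t + η) 0 with h4 | h4 <;>
      linarith

theorem abs_softThreshold_sub_le {η : ℝ} (hη : 0 ≤ η) (t : ℝ) : |softThreshold η t - t| ≤ η := by
  unfold softThreshold
  rw [abs_le]
  constructor <;> rcases max_cases (t - η) 0 with h1 | h1 <;>
    rcases min_cases (t + η) 0 with h2 | h2 <;> linarith

theorem softThreshold_eq_zero {η t : ℝ} (h : |t| ≤ η) : softThreshold η t = 0 := by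
  rw [abs_le] at h
  rw [softThreshold, max_eq_right (by linarith), min_eq_right (by linarith), add_zero]

/-- A Lipschitz function vanishing outside the bounded set `Ω` is a uniform limit of test functions
with the same Lipschitz constant: soft thresholding makes its support compact in `Ω`, and then it
can be mollified. -/
theorem exists_testFunction_of_lipschitzWith
    (hΩ : Bornology.IsBounded (Ω : Set (EuclideanSpace ℝ (Fin n))))
    {f : EuclideanSpace ℝ (Fin n) → ℝ} {L : NNReal} (hf : LipschitzWith L f)
    (hf0 : ∀ x ∉ Ω, f x = 0) {ε : ℝ} (hε : 0 < ε) :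
    ∃ φ : 𝓓(Ω, ℝ), (∀ x, ‖∇ (φ : EuclideanSpace ℝ (Fin n) → ℝ) x‖ ≤ L) ∧
      ∀ x, |φ x - f x| ≤ ε := by
  let η := ε / 2
  have hη : 0 < η := half_pos hε
  let k := softThreshold η ∘ f
  have hk : LipschitzWith L k := by
    simpa using (lipschitzWith_softThreshold hη.le).comp hf
  have hsub : tsupport k ⊆ {x | η ≤ |f x|} := by
    refine closure_minimal (fun x hx ↦ ?_) (isClosed_le continuous_const hf.continuous.abs)
    by_contra hlt
    exact hx (softThreshold_eq_zero (not_le.1 hlt).le)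
  have hsubΩ : tsupport k ⊆ Ω := fun x hx ↦ by
    by_contra hxΩ
    have : η ≤ |f x| := hsub hx
    rw [hf0 x hxΩ, abs_zero] at this
    exact absurd this (not_le.2 hη)
  have hkc : HasCompactSupport k :=
    isCompact_of_isClosed_isBounded (isClosed_tsupport k) (hΩ.subset hsubΩ)
  obtain ⟨δ, hδ, hδΩ⟩ := hkc.exists_cthickening_subset_open Ω.isOpen hsubΩ
  let r := min δ (η / (L + 1))
  have hr : 0 < r := lt_min hδ (by positivity)
  have hrδ : r ≤ δ := min_le_left _ _
  have hrη : L * r ≤ η := by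
    have h1 : r * (L + 1) ≤ η := (le_div_iff₀ (by positivity)).1 (min_le_right _ _)
    nlinarith
  let ρ : ContDiffBump (0 : EuclideanSpace ℝ (Fin n)) := ⟨r / 2, r, half_pos hr, half_lt_self hr⟩
  let Φ := ρ.normed volume ⋆[lsmul ℝ ℝ, volume] k
  have hki : Integrable k := hk.continuous.integrable_of_hasCompactSupport hkc
  have hΦsub : tsupport Φ ⊆ Ω := by
    refine (closure_minimal ?_ isClosed_cthickening).trans ((cthickening_mono hrδ _).trans hδΩ)
    refine (support_convolution_subset_swap _).trans ?_
    rw [ρ.support_normed_eq]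
    rintro _ ⟨a, ha, b, hb, rfl⟩
    refine mem_cthickening_of_dist_le _ a _ _ (subset_tsupport k ha) ?_
    have : ‖b‖ < r := mem_ball_zero_iff.1 hb
    simpa [dist_eq_norm] using this.le
  let φ : 𝓓(Ω, ℝ) := ⟨Φ,
    ρ.hasCompactSupport_normed.contDiff_convolution_left _ ρ.contDiff_normed
      hki.locallyIntegrable,
    isCompact_of_isClosed_isBounded (isClosed_tsupport Φ) (hΩ.subset hΦsub), hΦsub⟩
  have hΦ : ∀ x, Φ x = ∫ t, ρ.normed volume t * k (x - t) := fun x ↦ rfl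
  have hint : ∀ x, Integrable fun t ↦ ρ.normed volume t * k (x - t) := fun x ↦
    ((ρ.contDiff_normed (n := 0)).continuous.mul (hk.continuous.comp
      (continuous_const.sub continuous_id))).integrable_of_hasCompactSupport
      ρ.hasCompactSupport_normed.mul_right
  have hΦL : LipschitzWith L Φ := by
    refine LipschitzWith.of_dist_le_mul fun x y ↦ ?_
    rw [Real.dist_eq, hΦ, hΦ, ← integral_sub (hint x) (hint y)]
    have hb : ∀ t, ‖ρ.normed volume t * k (x - t) - ρ.normed volume t * k (y - t)‖ ≤
        ρ.normed volume t * (L * dist x y) := fun t ↦ by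
      rw [← mul_sub, norm_mul, Real.norm_of_nonneg (ρ.nonneg_normed t), ← dist_eq_norm]
      have := hk.dist_le_mul (x - t) (y - t)
      rw [dist_sub_right] at this
      exact mul_le_mul_of_nonneg_left this (ρ.nonneg_normed t)
    refine (norm_integral_le_of_norm_le (ρ.integrable_normed.mul_const _)
      (.of_forall hb)).trans_eq ?_
    rw [integral_mul_const, ρ.integral_normed, one_mul]
  refine ⟨φ, fun x ↦ ?_, fun x ↦ ?_⟩
  · rw [gradient, LinearIsometryEquiv.norm_map]
    exact norm_fderiv_le_of_lipschitz ℝ hΦL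
  · have h1 : dist (Φ x) (k x) ≤ η := ρ.dist_normed_convolution_le hki.1 fun z hz ↦ by
      refine (hk.dist_le_mul z x).trans (le_trans ?_ hrη)
      gcongr
      exact (mem_ball.1 hz).le
    have h2 := abs_softThreshold_sub_le hη.le (f x)
    calc |φ x - f x| ≤ |φ x - k x| + |k x - f x| := abs_sub_le _ _ _
      _ ≤ η + η := add_le_add h1 h2
      _ = ε := add_halves ε

theorem MemW1InfZero.exists_testFunction
    (hΩ : Bornology.IsBounded (Ω : Set (EuclideanSpace ℝ (Fin n)))) (h : MemW1InfZero Ω w)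
    (hG : HasWeakGradient Ω w G) {L : NNReal} (hGL : ∀ᵐ x ∂lebesgueOn Ω, ‖G x‖ ≤ L)
    {ε : ℝ} (hε : 0 < ε) :
    ∃ φ : 𝓓(Ω, ℝ), (∀ x, ‖∇ (φ : EuclideanSpace ℝ (Fin n) → ℝ) x‖ ≤ L) ∧
      ∀ᵐ x ∂lebesgueOn Ω, |φ x - w x| ≤ ε := by
  obtain ⟨w', hc, hww', h0⟩ := h.zero_boundary
  have : IsFiniteMeasure (lebesgueOn Ω) := ⟨by simpa using hΩ.measure_lt_top⟩
  have hw' : Integrable ((Ω : Set (EuclideanSpace ℝ (Fin n))).indicator w') := by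
    rw [integrable_indicator_iff Ω.isOpen.measurableSet]
    exact (h.memLp.integrable le_top).congr hww'.symm
  obtain ⟨φ, hφL, hφ⟩ := exists_testFunction_of_lipschitzWith hΩ
    ((hG.congr hww'.symm).lipschitzWith_indicator hw'.locallyIntegrable hGL hc h0)
    (fun x hx ↦ indicator_of_notMem (s := (Ω : Set _)) hx w') hε
  refine ⟨φ, hφL, ?_⟩
  filter_upwards [hww', ae_restrict_mem Ω.isOpen.measurableSet] with x hx hxΩ
  have := hφ x
  rwa [indicator_of_mem hxΩ, hx] at this

end Lipschitz

/-! ### Subgradients as divergences of measures -/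

section Subdifferential

variable {n : ℕ} {Ω : Opens (EuclideanSpace ℝ (Fin n))}

theorem inner_neg_eq_integral (D v : L2 Ω) : inner ℝ (-D) v = ∫ x in Ω, (-D x) * v x := by
  rw [L2.inner_def]
  refine integral_congr_ae ?_
  filter_upwards [Lp.coeFn_neg D] with x hx
  rw [hx]
  simp [mul_comm]

theorem inner_neg_testFunctionToL2 (D : L2 Ω) (φ : 𝓓(Ω, ℝ)) :
    inner ℝ (-D) (testFunctionToL2 Ω (lebesgueOn Ω) φ) = -∫ x in Ω, D x * φ x := by
  rw [inner_neg_eq_integral, ← integral_neg]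
  refine integral_congr_ae ?_
  filter_upwards [coeFn_testFunctionToL2 (lebesgueOn Ω) φ] with x hx
  rw [hx, neg_mul]

/-- If `ζ = -div q` with `|q|(Ω) ≤ 1`, then `⟪ζ, ·⟫ ≤ 𝒥`: this holds for test functions, which
approximate elements of `W^{1,∞}_0(Ω)` without increase of the gradient bound. -/
theorem inner_neg_le_functionalJ_of_hasMeasureDivergence
    (hΩ : Bornology.IsBounded (Ω : Set (EuclideanSpace ℝ (Fin n))))
    {q : VectorMeasure (EuclideanSpace ℝ (Fin n)) (EuclideanSpace ℝ (Fin n))}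
    (hq : IsVectorRadonMeasure Ω q) (hq1 : q.variation Ω ≤ 1) {D : L2 Ω}
    (hD : HasMeasureDivergence Ω q D) (v : L2 Ω) :
    ((inner ℝ (-D) v : ℝ) : EReal) ≤ functionalJ Ω v := by
  by_cases hv : MemW1InfZero Ω v
  swap
  · rw [functionalJ, if_neg hv]
    exact le_top
  obtain ⟨G, hG, hGb⟩ := hv.exists_grad
  rw [functionalJ_eq_eLpNorm hv hG .rfl]
  lift eLpNorm G ∞ (lebesgueOn Ω) to NNReal using hGb.2.ne with L hL
  have hGL : ∀ᵐ x ∂lebesgueOn Ω, ‖G x‖ ≤ L := by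
    rw [eLpNorm_exponent_top] at hL
    filter_upwards [enorm_ae_le_eLpNormEssSup G (lebesgueOn Ω)] with x hx
    rw [← hL, enorm_eq_nnnorm, ENNReal.coe_le_coe] at hx
    exact hx
  have hfin : IsFiniteMeasure q.variation := hq.finite
  have hq1' : q.variation.real univ ≤ 1 := by
    refine ENNReal.toReal_le_of_le_ofReal zero_le_one ?_
    rw [ENNReal.ofReal_one, ← measure_add_measure_compl Ω.isOpen.measurableSet, hq.carried,
      add_zero]
    exact hq1
  have : IsFiniteMeasure (lebesgueOn Ω) := ⟨by simpa using hΩ.measure_lt_top⟩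
  let M : ℝ := (measureUnivNNReal (lebesgueOn Ω) : ℝ) ^ (2 : ℝ≥0∞).toReal⁻¹
  have hM : 0 ≤ M := by positivity
  have key : inner ℝ (-D) v ≤ (L : ℝ) := by
    refine le_of_forall_pos_le_add fun ε hε ↦ ?_
    obtain ⟨φ, hφL, hφ⟩ := hv.exists_testFunction hΩ hG hGL
      (ε := ε / (‖D‖ * M + 1)) (by positivity)
    have h1 : inner ℝ (-D) (testFunctionToL2 Ω (lebesgueOn Ω) φ) ≤ L := by
      rw [inner_neg_testFunctionToL2, ← hD φ]
      refine (le_abs_self _).trans ((VectorMeasure.norm_integral_le_of_norm_le_const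
        (B := (innerSL ℝ : _ →L[ℝ] _ →L[ℝ] ℝ)) (.of_forall hφL)).trans ?_)
      calc (L : ℝ) * ‖innerSL ℝ‖ * q.variation.real univ ≤ L * 1 * 1 := by
            gcongr
            exact norm_innerSL_le _
        _ = L := by ring
    have h2 : ‖v - testFunctionToL2 Ω (lebesgueOn Ω) φ‖ ≤ M * (ε / (‖D‖ * M + 1)) := by
      refine Lp.norm_le_of_ae_bound (by positivity) ?_
      filter_upwards [hφ, Lp.coeFn_sub v (testFunctionToL2 Ω (lebesgueOn Ω) φ),
        coeFn_testFunctionToL2 (lebesgueOn Ω) φ] with x hx1 hx2 hx3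
      rw [hx2, Pi.sub_apply, hx3, Real.norm_eq_abs, abs_sub_comm]
      exact hx1
    have h3 : inner ℝ (-D) (v - testFunctionToL2 Ω (lebesgueOn Ω) φ) ≤ ε := by
      refine (real_inner_le_norm _ _).trans ?_
      rw [norm_neg]
      calc ‖D‖ * ‖v - testFunctionToL2 Ω (lebesgueOn Ω) φ‖
          ≤ ‖D‖ * (M * (ε / (‖D‖ * M + 1))) := by gcongr
        _ = ε * (‖D‖ * M / (‖D‖ * M + 1)) := by ring
        _ ≤ ε * 1 := by
          gcongr
          exact div_le_one_of_le₀ (by linarith) (by positivity)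
        _ = ε := mul_one ε
    rw [inner_sub_right] at h3
    linarith
  exact EReal.coe_le_coe_iff.2 key

/-- For the positively homogeneous functional `𝒥`, a subgradient `ζ` at `u` satisfies Euler's
identity `⟪ζ, u⟫ = 𝒥 u` and is dominated by `𝒥`. -/
theorem inner_eq_and_le_of_mem_subdifferential {u ζ : L2 Ω}
    (hζ : ζ ∈ subdifferential (functionalJ Ω) u) :
    ((inner ℝ ζ u : ℝ) : EReal) = functionalJ Ω u ∧
      ∀ v, ((inner ℝ ζ v : ℝ) : EReal) ≤ functionalJ Ω v := by
  have h0 := hζ 0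
  rw [functionalJ_zero, zero_sub, inner_neg_right] at h0
  have hu : MemW1InfZero Ω u := by
    by_contra hu
    rw [functionalJ, if_neg hu, EReal.top_add_coe] at h0
    exact absurd h0 (by simp)
  have h2 := hζ ((2 : ℝ) • u)
  rw [functionalJ_smul hu zero_le_two] at h2
  obtain ⟨G, hG, hGb⟩ := hu.exists_grad
  have hJ : functionalJ Ω u = (((eLpNorm G ∞ (lebesgueOn Ω)).toReal : ℝ) : EReal) := by
    rw [functionalJ_eq_eLpNorm hu hG .rfl, EReal.coe_ennreal_toReal hGb.2.ne]
  generalize (eLpNorm G ∞ (lebesgueOn Ω)).toReal = a at hJ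
  have e2 : (2 : ℝ) • u - u = u := by rw [two_smul, add_sub_cancel_right]
  rw [hJ, ← EReal.coe_add, ← EReal.coe_zero, EReal.coe_le_coe_iff] at h0
  rw [hJ, e2, ← EReal.coe_add, ← EReal.coe_mul, EReal.coe_le_coe_iff] at h2
  have ha : inner ℝ ζ u = a := by linarith
  refine ⟨by rw [hJ, ha], fun v ↦ ?_⟩
  have hv := hζ v
  rwa [hJ, ← EReal.coe_add, inner_sub_right, ha, add_sub_cancel] at hv

theorem isVectorRadonMeasure_withDensityᵥ {ν : Measure (EuclideanSpace ℝ (Fin n))}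
    {σ : EuclideanSpace ℝ (Fin n) → EuclideanSpace ℝ (Fin n)}
    (hσ : Integrable σ (ν.restrict Ω)) :
    IsVectorRadonMeasure Ω ((ν.restrict Ω).withDensityᵥ σ) := by
  constructor
  · rw [Measure.variation_withDensityᵥ hσ]
    exact isFiniteMeasure_withDensity hσ.2.ne
  · rw [Measure.variation_withDensityᵥ hσ]
    refine withDensity_absolutelyContinuous _ _ ?_
    rw [Measure.restrict_apply Ω.isOpen.measurableSet.compl, compl_inter_self, measure_empty]

theorem IsVectorRadonMeasure.sub
    {q r : VectorMeasure (EuclideanSpace ℝ (Fin n)) (EuclideanSpace ℝ (Fin n))}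
    (hq : IsVectorRadonMeasure Ω q) (hr : IsVectorRadonMeasure Ω r) :
    IsVectorRadonMeasure Ω (q - r) := by
  have := hq.finite
  have := hr.finite
  refine ⟨isFiniteMeasure_of_le _ VectorMeasure.variation_sub_le, ?_⟩
  refine le_antisymm ((VectorMeasure.variation_sub_le _).trans ?_) zero_le
  rw [Measure.add_apply, hq.carried, hr.carried, add_zero]

theorem IsVectorRadonMeasure.integrable_gradient
    {q : VectorMeasure (EuclideanSpace ℝ (Fin n)) (EuclideanSpace ℝ (Fin n))}
    (hq : IsVectorRadonMeasure Ω q) (φ : 𝓓(Ω, ℝ)) :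
    Integrable (∇ (φ : EuclideanSpace ℝ (Fin n) → ℝ)) q.variation :=
  have := hq.finite
  memLp_one_iff_integrable.1 (memLp_gradient_testFunction φ 1 _)

theorem integral_gradient_withDensityᵥ {ν : Measure (EuclideanSpace ℝ (Fin n))}
    {σ : EuclideanSpace ℝ (Fin n) → EuclideanSpace ℝ (Fin n)}
    (hσ : Integrable σ (ν.restrict Ω)) (φ : 𝓓(Ω, ℝ)) :
    ((ν.restrict Ω).withDensityᵥ σ).integral (∇ (φ : EuclideanSpace ℝ (Fin n) → ℝ)) (innerSL ℝ) =
      ∫ x in Ω, inner ℝ (∇ (φ : EuclideanSpace ℝ (Fin n) → ℝ) x) (σ x) ∂ν :=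
  integral_withDensityᵥ hσ ((isVectorRadonMeasure_withDensityᵥ hσ).integrable_gradient φ) _

/-- A functional `⟪ζ, ·⟫ ≤ 𝒥` is `-div q` for a measure `q` on `Ω` of total variation at most
`1`. -/
theorem exists_hasMeasureDivergence_of_inner_le {ζ : L2 Ω}
    (hζ : ∀ v, ((inner ℝ ζ v : ℝ) : EReal) ≤ functionalJ Ω v) :
    ∃ q : VectorMeasure (EuclideanSpace ℝ (Fin n)) (EuclideanSpace ℝ (Fin n)),
      IsVectorRadonMeasure Ω q ∧ q.variation Ω ≤ 1 ∧
        HasMeasureDivergence Ω q (-ζ : L2 Ω) := by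
  obtain ⟨ν, σ, hν, hσ, hσ1, hl⟩ := exists_density_integral_inner_gradient
    ((innerSL ℝ ζ).toLinearMap ∘ₗ testFunctionToL2 Ω (lebesgueOn Ω)) (fun φ C hC ↦ by
      have := (hζ _).trans (functionalJ_testFunction_le φ hC ((norm_nonneg _).trans (hC 0)))
      exact EReal.coe_le_coe_iff.1 this)
  have hσΩ : Integrable σ (ν.restrict Ω) := hσ.restrict
  refine ⟨(ν.restrict Ω).withDensityᵥ σ, isVectorRadonMeasure_withDensityᵥ hσΩ, ?_, fun φ ↦ ?_⟩
  · rw [Measure.variation_withDensityᵥ hσΩ, withDensity_apply _ Ω.isOpen.measurableSet]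
    exact ((setLIntegral_le_lintegral _ _).trans (setLIntegral_le_lintegral _ _)).trans hσ1
  · rw [integral_gradient_withDensityᵥ hσΩ, ← inner_neg_testFunctionToL2, neg_neg,
      setIntegral_eq_integral_of_forall_compl_eq_zero]
    · exact hl φ
    · intro x hx
      rw [gradient_testFunction_eq_zero_of_notMem φ hx, inner_zero_left]

/-- Every divergence in `L²(Ω)` of a measure on `Ω` is the divergence of a gradient field in
`G¹₀(Ω)`. In dimension `0` there is no Poincaré inequality, but then all divergences vanish. -/
theorem exists_memG1Zero_of_hasMeasureDivergence
    (hΩ : Bornology.IsBounded (Ω : Set (EuclideanSpace ℝ (Fin n))))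
    {q : VectorMeasure (EuclideanSpace ℝ (Fin n)) (EuclideanSpace ℝ (Fin n))} {D : L2 Ω}
    (hD : HasMeasureDivergence Ω q D) :
    ∃ g : EuclideanSpace ℝ (Fin n) → EuclideanSpace ℝ (Fin n),
      MemLp g 2 (lebesgueOn Ω) ∧ MemG1Zero Ω g ∧ ∀ φ : 𝓓(Ω, ℝ),
        ∫ x in Ω, (inner ℝ (∇ (φ : EuclideanSpace ℝ (Fin n) → ℝ) x) (g x) : ℝ)
          = - ∫ x in Ω, D x * φ x := by
  rcases eq_or_ne n 0 with rfl | hn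
  · refine ⟨0, MemLp.zero, memG1Zero_zero, fun φ ↦ ?_⟩
    have h0 : ∇ (φ : EuclideanSpace ℝ (Fin 0) → ℝ) = 0 := Subsingleton.elim _ _
    rw [← hD φ, h0]
    refine Eq.trans (by simp) VectorMeasure.integral_zero.symm
  · obtain ⟨g, hg2, hg, hdiv⟩ := exists_memG1Zero_hasWeakDivergence hn hΩ D
    exact ⟨g, hg2, hg, hdiv.integral_eq⟩

end Subdifferential

/-! ### Characterization of the subdifferential -/

theorem proposition2p3 (n : ℕ) (Ω : TopologicalSpace.Opens (EuclideanSpace ℝ (Fin n)))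
    (hΩ : Bornology.IsBounded (Ω : Set (EuclideanSpace ℝ (Fin n)))) (u : L2 Ω) :
    subdifferential (functionalJ Ω) u =
      {ζ : L2 Ω |
        ∃ q : VectorMeasure (EuclideanSpace ℝ (Fin n)) (EuclideanSpace ℝ (Fin n)),
        ∃ g : EuclideanSpace ℝ (Fin n) → EuclideanSpace ℝ (Fin n),
        ∃ r : VectorMeasure (EuclideanSpace ℝ (Fin n)) (EuclideanSpace ℝ (Fin n)),
        ∃ D : L2 Ω,
          IsVectorRadonMeasure Ω q ∧ MemG1Zero Ω g ∧ MemSolenoidal Ω r ∧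
          q = (lebesgueOn Ω).withDensityᵥ g + r ∧
          HasMeasureDivergence Ω q D ∧ ζ = -D ∧
          ((∫ x in Ω, (-D x) * u x : ℝ) : EReal) = functionalJ Ω u ∧
          q.variation Ω ≤ 1} := by
  have : IsFiniteMeasure (lebesgueOn Ω) := ⟨by simpa using hΩ.measure_lt_top⟩
  ext ζ
  constructor
  · intro hζ
    obtain ⟨hζu, hζJ⟩ := inner_eq_and_le_of_mem_subdifferential hζ
    obtain ⟨q, hq, hq1, hD⟩ := exists_hasMeasureDivergence_of_inner_le hζJ
    obtain ⟨g, hg2, hg, hgD⟩ := exists_memG1Zero_of_hasMeasureDivergence hΩ hD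
    have hgi : Integrable g (lebesgueOn Ω) := hg2.integrable one_le_two
    have hgq := isVectorRadonMeasure_withDensityᵥ hgi
    refine ⟨q, g, q - (lebesgueOn Ω).withDensityᵥ g, -ζ, hq, hg, ⟨hq.sub hgq, fun φ ↦ ?_⟩,
      (add_sub_cancel _ _).symm, hD, (neg_neg ζ).symm, ?_, hq1⟩
    · rw [VectorMeasure.integral_sub_vectorMeasure (hq.integrable_gradient φ)
        (hgq.integrable_gradient φ), hD φ, integral_gradient_withDensityᵥ hgi, hgD φ]
      simp
    · rw [← inner_neg_eq_integral, neg_neg]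
      exact hζu
  · rintro ⟨q, g, r, D, hq, -, -, -, hD, rfl, hu, hq1⟩ v
    rw [← hu, ← inner_neg_eq_integral, ← EReal.coe_add, inner_sub_right, add_sub_cancel]
    exact inner_neg_le_functionalJ_of_hasMeasureDivergence hΩ hq hq1 hD v
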